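/- **Definitions.** All ideals of $C^*$-algebras are closed and two-sided. A $C^*$-algebra $A$ is *semiprojective* if for every $C^*$-algebra $B$, every increasing sequence $J_0\subset J_1\subset\cdots$ of ideals of $B$ with $J=\overline{\bigcup_n J_n}$, and every $*$-homomorphism $\varphi:A\to B/J$, there are $n$ and a $*$-homomorphism $\bar\varphi:A\to B/J_n$ whose composition with the quotient map $B/J_n\to B/J$ is $\varphi$. Let $\mathcal C$ be a class of separable unital $C^*$-algebras. A class is *finitely saturated* if it is closed under $*$-isomorphism, under finite direct sums $\bigoplus_{k=1}^n A_k$ ($n\ge 1$), under passing from $A$ to $M_n(A)$ ($n\ge1$), and under passing from $A$ to $pAp$ for a nonzero projection $p\in A$. The *finite saturation* of $\mathcal C$ is the smallest finitely saturated class containing $\mathcal C$. The class $\mathcal C$ is *flexible* if 1. for every $A\in\mathcal C$, every $n\in\mathbb N$ and every nonzero projection $p\in M_n(A)$, the corner $pM_n(A)p$ is semiprojective and finitely generated as a $C^*$-algebra; and 2. for every $A\in\mathcal C$ and every proper ideal $I\subsetneq A$ there is an increasing sequence $I_0\subset I_1\subset\cdots$ of ideals of $A$ with $\overline{\bigcup_n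 I_n}=I$ such that every $A/I_n$ is in the finite saturation of $\mathcal C$. A *unital local $\mathcal C$-algebra* is a separable unital $C^*$-algebra $A$ such that for every finite set $S\subset A$ and every $\varepsilon>0$ there are a $C^*$-algebra $B$ in the finite saturation of $\mathcal C$ and a unital $*$-homomorphism $\varphi:B\to A$ with $\operatorname{dist}(a,\varphi(B))<\varepsilon$ for all $a\in S$. Let $A\supset P$ be an inclusion of unital $C^*$-algebras with common unit and $E:A\to P$ a conditional expectation. A *quasi-basis* for $E$ is a finite family $(u_i,v_i)_{i=1}^n$ in $A\times A$ with $a=\sum_i u_iE(v_ia)=\sum_iE(au_i)v_i$ for all $a\in A$. $E$ has *finite index* if a quasi-basis exists, and then $\operatorname{Index}E=\sum_iu_iv_i$, which does not depend on the quasi-basis and is a central invertible element of $A$. Put $A^\infty=\ell^\infty(\mathbb N,A)/c_0(A)$, which contains $A$ as (classes of) constant sequences and contains $P^\infty$, let $A_\infty=A^\infty\cap A'$, and let $E^\infty:A^\infty\to P^\infty$ be induced by $E$. $A\supset P$ is a *finite-index inclusion with the Rohlin property* if there are a conditional expectation $E:A\to P$ of finite index and a projection $e\in A_\infty$ such that $E^\infty(e)=(\operatorname{Index}E)^{-1}$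 and the map $A\ni x\mapsto xe$ is injective. **Theorem.** Let $\mathcal C$ be a flexible class of separable unital $C^*$-algebras, and let $A\supset P$ be a finite-index inclusion with the Rohlin property. If $A$ is a unital local $\mathcal C$-algebra, then $P$ is also a unital local $\mathcal C$-algebra. -/

import Mathlib

open scoped ENNReal Topology
open Filter

universe u

noncomputable section

/-! ### Closed two-sided ideals and quotients -/

/-- A closed two-sided ideal of a (not necessarily unital) C*-algebra. Such an ideal is
automatically closed under scalar multiplication and under the involution, so those two
requirements exclude nothing. -/
structure CStarIdeal (B : Type*) [NonUnitalCStarAlgebra B] extends Submodule ℂ B where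
  mul_mem_left' : ∀ b x : B, x ∈ carrier → b * x ∈ carrier
  mul_mem_right' : ∀ x b : B, x ∈ carrier → x * b ∈ carrier
  star_mem' : ∀ x : B, x ∈ carrier → star x ∈ carrier
  isClosed' : IsClosed carrier

namespace CStarIdeal

variable {B : Type*} [NonUnitalCStarAlgebra B]

/-- The quotient `B / J` as a *-algebra. (A *-homomorphism between C*-algebras is the same thing
as a homomorphism of the underlying *-algebras, so the quotient norm plays no role below.) -/
def Quotient (J : CStarIdeal B) : Type _ := B ⧸ J.toSubmodule

instance (J : CStarIdeal B) : AddCommGroup J.Quotient :=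
  inferInstanceAs (AddCommGroup (B ⧸ J.toSubmodule))

instance (J : CStarIdeal B) : Module ℂ J.Quotient :=
  inferInstanceAs (Module ℂ (B ⧸ J.toSubmodule))

/-- The class of an element in the quotient. -/
def toQuot (J : CStarIdeal B) : B →ₗ[ℂ] J.Quotient := J.toSubmodule.mkQ

theorem toQuot_surjective (J : CStarIdeal B) : Function.Surjective J.toQuot :=
  J.toSubmodule.mkQ_surjective

theorem toQuot_eq_iff (J : CStarIdeal B) {x y : B} :
    J.toQuot x = J.toQuot y ↔ x - y ∈ J.toSubmodule :=
  Submodule.Quotient.eq J.toSubmodule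

theorem toQuot_mul_congr (J : CStarIdeal B) {a b c d : B}
    (h₁ : J.toQuot a = J.toQuot c) (h₂ : J.toQuot b = J.toQuot d) :
    J.toQuot (a * b) = J.toQuot (c * d) := by
  rw [toQuot_eq_iff] at *
  have e : a * b - c * d = (a - c) * b + c * (b - d) := by
    rw [sub_mul, mul_sub]; abel
  rw [e]
  exact J.toSubmodule.add_mem (J.mul_mem_right' _ _ h₁) (J.mul_mem_left' _ _ h₂)

theorem toQuot_star_congr (J : CStarIdeal B) {a c : B}
    (h : J.toQuot a = J.toQuot c) : J.toQuot (star a) = J.toQuot (star c) := by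
  rw [toQuot_eq_iff] at *
  rw [← star_sub]
  exact J.star_mem' _ h

instance (J : CStarIdeal B) : Mul J.Quotient where
  mul x y := Quotient.liftOn₂' x y (fun a b => J.toQuot (a * b)) fun _ _ _ _ h₁ h₂ =>
    J.toQuot_mul_congr (Quotient.sound' h₁) (Quotient.sound' h₂)

instance (J : CStarIdeal B) : Star J.Quotient where
  star x := Quotient.liftOn' x (fun a => J.toQuot (star a)) fun _ _ h =>
    J.toQuot_star_congr (Quotient.sound' h)

theorem toQuot_mul (J : CStarIdeal B) (a b : B) :
    J.toQuot (a * b) = J.toQuot a * J.toQuot b := rfl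

theorem toQuot_star (J : CStarIdeal B) (a : B) :
    J.toQuot (star a) = star (J.toQuot a) := rfl

instance (J : CStarIdeal B) : NonUnitalRing J.Quotient :=
  { (inferInstance : AddCommGroup J.Quotient), (inferInstance : Mul J.Quotient) with
    left_distrib := by
      intro x y z
      obtain ⟨a, rfl⟩ := J.toQuot_surjective x
      obtain ⟨b, rfl⟩ := J.toQuot_surjective y
      obtain ⟨c, rfl⟩ := J.toQuot_surjective z
      rw [← map_add, ← toQuot_mul, ← toQuot_mul, ← toQuot_mul, ← map_add, mul_add]
    right_distrib := by
      intro x y z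
      obtain ⟨a, rfl⟩ := J.toQuot_surjective x
      obtain ⟨b, rfl⟩ := J.toQuot_surjective y
      obtain ⟨c, rfl⟩ := J.toQuot_surjective z
      rw [← map_add, ← toQuot_mul, ← toQuot_mul, ← toQuot_mul, ← map_add, add_mul]
    zero_mul := by
      intro x
      obtain ⟨a, rfl⟩ := J.toQuot_surjective x
      rw [← map_zero J.toQuot, ← toQuot_mul, zero_mul]
    mul_zero := by
      intro x
      obtain ⟨a, rfl⟩ := J.toQuot_surjective x
      rw [← map_zero J.toQuot, ← toQuot_mul, mul_zero]
    mul_assoc := by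
      intro x y z
      obtain ⟨a, rfl⟩ := J.toQuot_surjective x
      obtain ⟨b, rfl⟩ := J.toQuot_surjective y
      obtain ⟨c, rfl⟩ := J.toQuot_surjective z
      rw [← toQuot_mul, ← toQuot_mul, ← toQuot_mul, ← toQuot_mul, mul_assoc] }

instance (J : CStarIdeal B) : StarRing J.Quotient where
  star_involutive x := by
    obtain ⟨a, rfl⟩ := J.toQuot_surjective x
    rw [← toQuot_star, ← toQuot_star, star_star]
  star_mul x y := by
    obtain ⟨a, rfl⟩ := J.toQuot_surjective x
    obtain ⟨b, rfl⟩ := J.toQuot_surjective y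
    rw [← toQuot_mul, ← toQuot_star, ← toQuot_star, ← toQuot_star, ← toQuot_mul, star_mul]
  star_add x y := by
    obtain ⟨a, rfl⟩ := J.toQuot_surjective x
    obtain ⟨b, rfl⟩ := J.toQuot_surjective y
    rw [← map_add, ← toQuot_star, ← toQuot_star, ← toQuot_star, ← map_add, star_add]

instance (J : CStarIdeal B) : StarModule ℂ J.Quotient where
  star_smul r x := by
    obtain ⟨a, rfl⟩ := J.toQuot_surjective x
    rw [← map_smul, ← toQuot_star, ← toQuot_star, ← map_smul, star_smul]

instance (J : CStarIdeal B) : IsScalarTower ℂ J.Quotient J.Quotient where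
  smul_assoc r x y := by
    obtain ⟨a, rfl⟩ := J.toQuot_surjective x
    obtain ⟨b, rfl⟩ := J.toQuot_surjective y
    rw [smul_eq_mul, smul_eq_mul, ← map_smul, ← toQuot_mul, ← toQuot_mul, ← map_smul,
      smul_mul_assoc]

instance (J : CStarIdeal B) : SMulCommClass ℂ J.Quotient J.Quotient where
  smul_comm r x y := by
    obtain ⟨a, rfl⟩ := J.toQuot_surjective x
    obtain ⟨b, rfl⟩ := J.toQuot_surjective y
    rw [smul_eq_mul, smul_eq_mul, ← map_smul, ← toQuot_mul, ← toQuot_mul, ← map_smul,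
      mul_smul_comm]

/-- The quotient map `B → B / J`, a *-homomorphism. -/
def quotMk (J : CStarIdeal B) : B →⋆ₙₐ[ℂ] J.Quotient where
  toFun := J.toQuot
  map_smul' := map_smul J.toQuot
  map_zero' := map_zero J.toQuot
  map_add' := map_add J.toQuot
  map_mul' := J.toQuot_mul
  map_star' := J.toQuot_star

/-- The natural map `B / J → B / I` for ideals `J ⊆ I`. -/
def factor {J I : CStarIdeal B} (h : J.toSubmodule ≤ I.toSubmodule) : J.Quotient → I.Quotient :=
  Submodule.factor h

theorem factor_quotMk {J I : CStarIdeal B} (h : J.toSubmodule ≤ I.toSubmodule) (b : B) :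
    factor h (J.quotMk b) = I.quotMk b := rfl

/-- `I₀ ⊆ I₁ ⊆ ⋯` is an increasing sequence of ideals with `closure (⋃ Iₙ) = I`. -/
structure IsIncreasingLimit (J : ℕ → CStarIdeal B) (I : CStarIdeal B) : Prop where
  mono : ∀ m n, m ≤ n → (J m).toSubmodule ≤ (J n).toSubmodule
  closure_eq : closure (⋃ n, (J n).carrier) = I.carrier

theorem IsIncreasingLimit.le {J : ℕ → CStarIdeal B} {I : CStarIdeal B}
    (h : IsIncreasingLimit J I) (n : ℕ) : (J n).toSubmodule ≤ I.toSubmodule := by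
  intro x hx
  have : x ∈ closure (⋃ n, (J n).carrier) := subset_closure (Set.mem_iUnion.2 ⟨n, hx⟩)
  rw [h.closure_eq] at this
  exact this

end CStarIdeal

/-! ### Semiprojectivity and finite generation -/

/-- `A` is semiprojective: whenever `B` is a C*-algebra, `J₀ ⊆ J₁ ⊆ ⋯` are ideals of `B` and
`I` is the closure of their union, every *-homomorphism `A → B / I` lifts to a *-homomorphism
`A → B / Jₙ` for some `n`. -/
def IsSemiprojective (A : Type u) [NonUnitalCStarAlgebra A] : Prop :=
  ∀ (B : Type u) [NonUnitalCStarAlgebra B] (J : ℕ → CStarIdeal B) (I : CStarIdeal B)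
    (h : CStarIdeal.IsIncreasingLimit J I) (φ : A →⋆ₙₐ[ℂ] I.Quotient),
    ∃ (n : ℕ) (ψ : A →⋆ₙₐ[ℂ] (J n).Quotient), ∀ a, CStarIdeal.factor (h.le n) (ψ a) = φ a

/-- `A` is finitely generated as a C*-algebra. -/
def IsFinitelyGeneratedCStar (A : Type u) [CStarAlgebra A] : Prop :=
  ∃ S : Set A, S.Finite ∧ (StarAlgebra.adjoin ℂ S).topologicalClosure = ⊤

/-! ### Matrix algebras and corners -/

/-- The C*-algebra structure of `Mₙ(A)`. -/
instance matrixCStarAlgebra (n : ℕ) (A : Type u) [CStarAlgebra A] :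
    CStarAlgebra (CStarMatrix (Fin n) (Fin n) A) :=
  letI := CStarAlgebra.spectralOrder A
  haveI := CStarAlgebra.spectralOrderedRing A
  CStarMatrix.instCStarAlgebra

/-- The corner `pAp` of `A` at a projection `p`, as a closed *-subalgebra. -/
def cornerSubalgebra {A : Type u} [CStarAlgebra A] (p : A) (hp : IsStarProjection p) :
    NonUnitalStarSubalgebra ℂ A where
  carrier := Set.range fun a : A => p * a * p
  zero_mem' := ⟨0, by simp⟩
  add_mem' := by
    rintro _ _ ⟨a, rfl⟩ ⟨b, rfl⟩
    exact ⟨a + b, by simp [mul_add, add_mul]⟩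
  mul_mem' := by
    rintro _ _ ⟨a, rfl⟩ ⟨b, rfl⟩
    exact ⟨a * p * p * b, by simp only [mul_assoc]⟩
  smul_mem' := by
    rintro c _ ⟨a, rfl⟩
    exact ⟨c • a, by simp⟩
  star_mem' := by
    rintro _ ⟨a, rfl⟩
    exact ⟨star a, by simp [hp.isSelfAdjoint.star_eq, mul_assoc]⟩

theorem mem_cornerSubalgebra_iff {A : Type u} [CStarAlgebra A] {p : A} {hp : IsStarProjection p}
    {x : A} : x ∈ cornerSubalgebra p hp ↔ p * x = x ∧ x * p = x := by
  have hpp : p * p = p := hp.isIdempotentElem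
  constructor
  · rintro ⟨a, rfl⟩
    exact ⟨by simp only [← mul_assoc, hpp], by simp only [mul_assoc, hpp]⟩
  · rintro ⟨h₁, h₂⟩
    exact ⟨x, by simp only [h₁, h₂]⟩

theorem isClosed_cornerSubalgebra {A : Type u} [CStarAlgebra A] (p : A)
    (hp : IsStarProjection p) : IsClosed (cornerSubalgebra p hp : Set A) := by
  have : (cornerSubalgebra p hp : Set A) = {x | p * x = x} ∩ {x | x * p = x} := by
    ext x
    exact mem_cornerSubalgebra_iff
  rw [this]
  exact (isClosed_eq (by fun_prop) continuous_id).inter (isClosed_eq (by fun_prop) continuous_id)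

/-- The corner `pAp`; it is a unital C*-algebra with the operations of `A` and the unit `p`. -/
def Corner {A : Type u} [CStarAlgebra A] (p : A) (hp : IsStarProjection p) : Type u :=
  ↥(cornerSubalgebra p hp)

instance {A : Type u} [CStarAlgebra A] (p : A) (hp : IsStarProjection p) :
    NonUnitalCStarAlgebra (Corner p hp) :=
  haveI := isClosed_cornerSubalgebra p hp
  inferInstanceAs (NonUnitalCStarAlgebra ↥(cornerSubalgebra p hp))

instance {A : Type u} [CStarAlgebra A] (p : A) (hp : IsStarProjection p) :
    One (Corner p hp) where
  one := ⟨p, mem_cornerSubalgebra_iff.2 ⟨hp.isIdempotentElem, hp.isIdempotentElem⟩⟩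

instance {A : Type u} [CStarAlgebra A] (p : A) (hp : IsStarProjection p) :
    NormedRing (Corner p hp) :=
  { (inferInstance : NonUnitalNormedRing (Corner p hp)), (inferInstance : One (Corner p hp)) with
    one_mul := fun x => Subtype.ext (mem_cornerSubalgebra_iff.1 x.2).1
    mul_one := fun x => Subtype.ext (mem_cornerSubalgebra_iff.1 x.2).2 }

instance {A : Type u} [CStarAlgebra A] (p : A) (hp : IsStarProjection p) :
    NormedAlgebra ℂ (Corner p hp) :=
  { Algebra.ofModule (R := ℂ) (A := Corner p hp) smul_mul_assoc mul_smul_comm with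
    norm_smul_le := fun r x => norm_smul_le r x }

instance {A : Type u} [CStarAlgebra A] (p : A) (hp : IsStarProjection p) :
    CStarAlgebra (Corner p hp) where
  star_involutive := star_involutive
  star_mul := star_mul
  star_add := star_add
  complete := CompleteSpace.complete
  norm_mul_self_le := CStarRing.norm_mul_self_le
  star_smul := star_smul

/-! ### Classes of C*-algebras -/

/-- A class of unital C*-algebras. -/
def CStarClass : Type (u + 1) := ∀ (A : Type u) [CStarAlgebra A], Prop

namespace CStarClass

/-- All members of the class are separable. -/
def IsSeparable (𝒞 : CStarClass.{u}) : Prop :=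
  ∀ (A : Type u) [CStarAlgebra A], 𝒞 A → TopologicalSpace.SeparableSpace A

/-- The class is closed under isomorphism, (nonempty) finite direct sums, matrix algebras over
members, and corners of members at nonzero projections. -/
structure IsFinitelySaturated (𝒞 : CStarClass.{u}) : Prop where
  of_iso : ∀ (A B : Type u) [CStarAlgebra A] [CStarAlgebra B],
    𝒞 A → Nonempty (B ≃⋆ₐ[ℂ] A) → 𝒞 B
  directSum : ∀ (n : ℕ), 1 ≤ n → ∀ (A : Fin n → Type u) [∀ k, CStarAlgebra (A k)],
    (∀ k, 𝒞 (A k)) → 𝒞 (∀ k, A k)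
  matrix : ∀ (A : Type u) [CStarAlgebra A] (n : ℕ), 1 ≤ n →
    𝒞 A → 𝒞 (CStarMatrix (Fin n) (Fin n) A)
  corner : ∀ (A : Type u) [CStarAlgebra A] (p : A) (hp : IsStarProjection p), p ≠ 0 →
    𝒞 A → 𝒞 (Corner p hp)

/-- The finite saturation: the smallest finitely saturated class containing `𝒞`. -/
def finiteSaturation (𝒞 : CStarClass.{u}) : CStarClass.{u} := fun A _ =>
  ∀ 𝒟 : CStarClass.{u}, 𝒟.IsFinitelySaturated →
    (∀ (B : Type u) [CStarAlgebra B], 𝒞 B → 𝒟 B) → 𝒟 A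

/-- Flexible classes. In the second condition the ideal `I` is a proper one (for `I = A` the
quotients `A / Iₙ` would eventually be the zero algebra). -/
structure IsFlexible (𝒞 : CStarClass.{u}) : Prop where
  corner : ∀ (A : Type u) [CStarAlgebra A], 𝒞 A → ∀ (n : ℕ)
    (p : CStarMatrix (Fin n) (Fin n) A) (hp : IsStarProjection p), p ≠ 0 →
      IsSemiprojective (Corner p hp) ∧ IsFinitelyGeneratedCStar (Corner p hp)
  quotient : ∀ (A : Type u) [CStarAlgebra A], 𝒞 A → ∀ I : CStarIdeal A, I.toSubmodule ≠ ⊤ →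
    ∃ J : ℕ → CStarIdeal A, CStarIdeal.IsIncreasingLimit J I ∧
      ∀ n, ∃ (D : Type u) (_ : CStarAlgebra D), 𝒞.finiteSaturation D ∧
        Nonempty ((J n).Quotient ≃⋆ₐ[ℂ] D)

/-- `A` is a unital local `𝒞`-algebra. -/
structure IsUnitalLocal (𝒞 : CStarClass.{u}) (A : Type u) [CStarAlgebra A] : Prop where
  separable : TopologicalSpace.SeparableSpace A
  approx : ∀ (S : Finset A) (ε : ℝ), 0 < ε →
    ∃ (B : Type u) (_ : CStarAlgebra B), 𝒞.finiteSaturation B ∧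
      ∃ φ : B →⋆ₐ[ℂ] A, ∀ a ∈ S, Metric.infDist a (Set.range φ) < ε

end CStarClass

/-! ### Conditional expectations and the Watatani index -/

/-- A conditional expectation of the unital C*-algebra `A` onto its C*-subalgebra `P`. -/
structure CondExpectation {A : Type u} [CStarAlgebra A] (P : StarSubalgebra ℂ A) where
  toMap : A →L[ℂ] P
  map_coe : ∀ x : P, toMap (x : A) = x
  map_mul_mul : ∀ (x : P) (a : A) (y : P), toMap (x * a * y) = x * toMap a * y
  map_nonneg : ∀ a : A, ∃ b : P, toMap (star a * a) = star b * b
  norm_map_le : ∀ a : A, ‖toMap a‖ ≤ ‖a‖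

namespace CondExpectation

variable {A : Type u} [CStarAlgebra A] {P : StarSubalgebra ℂ A}

/-- A quasi-basis of a conditional expectation. -/
structure QuasiBasis (E : CondExpectation P) where
  n : ℕ
  u : Fin n → A
  v : Fin n → A
  eq_left : ∀ a : A, a = ∑ i, u i * (E.toMap (v i * a) : A)
  eq_right : ∀ a : A, a = ∑ i, (E.toMap (a * u i) : A) * v i

/-- `E` has finite (Watatani) index. -/
def FiniteIndex (E : CondExpectation P) : Prop := Nonempty E.QuasiBasis

/-- The Watatani index `Index E = ∑ uᵢ vᵢ`, computed from some quasi-basis; by `index_eq` it does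
not depend on the quasi-basis. -/
def index (E : CondExpectation P) (h : E.FiniteIndex) : A :=
  ∑ i, h.some.u i * h.some.v i

theorem index_eq (E : CondExpectation P) (h : E.FiniteIndex) (q : E.QuasiBasis) :
    E.index h = ∑ i, q.u i * q.v i := by
  have key : ∀ q r : E.QuasiBasis, ∑ i, q.u i * q.v i = ∑ j, r.u j * r.v j := by
    intro q r
    calc ∑ i, q.u i * q.v i
        = ∑ i, q.u i * ∑ j, (E.toMap (q.v i * r.u j) : A) * r.v j :=
          Finset.sum_congr rfl fun i _ => by rw [← r.eq_right]
      _ = ∑ j, (∑ i, q.u i * (E.toMap (q.v i * r.u j) : A)) * r.v j := by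
          simp only [Finset.mul_sum, Finset.sum_mul, mul_assoc]
          exact Finset.sum_comm
      _ = ∑ j, r.u j * r.v j :=
          Finset.sum_congr rfl fun j _ => by rw [← q.eq_left]
  exact key _ q

end CondExpectation

/-! ### The sequence algebra `A^∞ = ℓ^∞(ℕ, A) / c₀(A)` -/

/-- Bounded sequences in `A`. -/
abbrev BddSeq (A : Type u) [CStarAlgebra A] : Type u := ↥(lp (fun _ : ℕ => A) ∞)

/-- The ideal of sequences converging to `0` in norm. -/
def c0Ideal (A : Type u) [CStarAlgebra A] : CStarIdeal (BddSeq A) where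
  carrier := {f | Tendsto (fun n => ‖f n‖) atTop (𝓝 0)}
  zero_mem' := by simp
  add_mem' := by
    intro f g hf hg
    simp only [Set.mem_ofPred_eq] at *
    rw [tendsto_zero_iff_norm_tendsto_zero.symm] at *
    have h := hf.add hg
    rw [add_zero] at h
    exact h
  smul_mem' := by
    intro c f hf
    simp only [Set.mem_ofPred_eq] at *
    rw [tendsto_zero_iff_norm_tendsto_zero.symm] at *
    have h := hf.const_smul c
    rw [smul_zero] at h
    exact h
  mul_mem_left' := by
    intro b f hf
    simp only [Set.mem_ofPred_eq] at *
    refine squeeze_zero (fun n => norm_nonneg _) (fun n => ?_)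
      (by simpa using hf.const_mul ‖b‖)
    exact (norm_mul_le (b n) (f n)).trans
      (mul_le_mul_of_nonneg_right (lp.norm_apply_le_norm (by simp) b n) (norm_nonneg _))
  mul_mem_right' := by
    intro f b hf
    simp only [Set.mem_ofPred_eq] at *
    refine squeeze_zero (fun n => norm_nonneg _) (fun n => ?_)
      (by simpa using hf.mul_const ‖b‖)
    exact (norm_mul_le (f n) (b n)).trans
      (mul_le_mul_of_nonneg_left (lp.norm_apply_le_norm (by simp) b n) (norm_nonneg _))
  star_mem' := by
    intro f hf
    simpa using hf
  isClosed' := by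
    refine isClosed_of_closure_subset fun f hf => ?_
    rw [Metric.mem_closure_iff] at hf
    rw [Set.mem_ofPred_eq, Metric.tendsto_atTop]
    intro ε hε
    obtain ⟨g, hg, hfg⟩ := hf (ε / 2) (half_pos hε)
    rw [Set.mem_ofPred_eq, Metric.tendsto_atTop] at hg
    obtain ⟨N, hN⟩ := hg (ε / 2) (half_pos hε)
    refine ⟨N, fun n hn => ?_⟩
    have h₁ := hN n hn
    rw [dist_zero_right, norm_norm] at h₁ ⊢
    have h₂ : ‖f n - g n‖ ≤ ‖f - g‖ := lp.norm_apply_le_norm (by simp) (f - g) n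
    rw [dist_eq_norm] at hfg
    have h₃ : ‖f n‖ ≤ ‖f n - g n‖ + ‖g n‖ := by
      simpa using norm_add_le (f n - g n) (g n)
    linarith

/-- The algebra `A^∞ = ℓ^∞(ℕ, A) / c₀(A)`. -/
abbrev SeqAlg (A : Type u) [CStarAlgebra A] : Type u := (c0Ideal A).Quotient

/-- The constant sequence with value `a`. -/
def constSeq {A : Type u} [CStarAlgebra A] (a : A) : BddSeq A :=
  ⟨fun _ => a, memℓp_infty ⟨‖a‖, by rintro _ ⟨n, rfl⟩; exact le_rfl⟩⟩

/-- The embedding of `A` in `A^∞` as classes of constant sequences. -/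
def toSeqAlg {A : Type u} [CStarAlgebra A] (a : A) : SeqAlg A := (c0Ideal A).quotMk (constSeq a)

/-- `A_∞ = A^∞ ∩ A'`. -/
def centralSeq (A : Type u) [CStarAlgebra A] : Set (SeqAlg A) :=
  {x | ∀ a : A, toSeqAlg a * x = x * toSeqAlg a}

/-- A bounded linear map applied termwise to a bounded sequence. -/
def bddSeqMap {A B : Type u} [CStarAlgebra A] [CStarAlgebra B] (T : A →L[ℂ] B) :
    BddSeq A →ₗ[ℂ] BddSeq B where
  toFun f := ⟨fun n => T (f n), memℓp_infty ⟨‖T‖ * ‖f‖, by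
    rintro _ ⟨n, rfl⟩
    exact (T.le_opNorm _).trans
      (mul_le_mul_of_nonneg_left (lp.norm_apply_le_norm (by simp) f n) (norm_nonneg _))⟩⟩
  map_add' f g := by ext n; exact map_add T (f n) (g n)
  map_smul' c f := by ext n; exact map_smul T c (f n)

/-- The map `T^∞ : A^∞ → B^∞` induced by a bounded linear map `T : A → B`. -/
def seqMap {A B : Type u} [CStarAlgebra A] [CStarAlgebra B] (T : A →L[ℂ] B) :
    SeqAlg A →ₗ[ℂ] SeqAlg B :=
  Submodule.mapQ (c0Ideal A).toSubmodule (c0Ideal B).toSubmodule (bddSeqMap T) (by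
    intro f hf
    have hf' : Tendsto (fun n => ‖f n‖) atTop (𝓝 0) := hf
    have : Tendsto (fun n => ‖T (f n)‖) atTop (𝓝 0) :=
      squeeze_zero (fun n => norm_nonneg _) (fun n => T.le_opNorm (f n))
        (by simpa using hf'.const_mul ‖T‖)
    exact this)

theorem seqMap_quotMk {A B : Type u} [CStarAlgebra A] [CStarAlgebra B] (T : A →L[ℂ] B)
    (f : BddSeq A) : seqMap T ((c0Ideal A).quotMk f) = (c0Ideal B).quotMk (bddSeqMap T f) := rfl

/-! ### The Rohlin property -/

/-- The inclusion `P → A` as a bounded linear map. -/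
def inclL {A : Type u} [CStarAlgebra A] (P : StarSubalgebra ℂ A) : P →L[ℂ] A :=
  { P.subtype.toAlgHom.toLinearMap with cont := continuous_subtype_val }

/-- A conditional expectation `E : A → P` has the Rohlin property: it has finite index and there
is a projection `e ∈ A_∞` such that `E^∞(e)`, regarded in `A^∞ ⊇ P^∞`, is the inverse of
`Index E`, and such that `x ↦ x e` is injective on `A`. -/
def CondExpectation.HasRohlinProperty {A : Type u} [CStarAlgebra A] {P : StarSubalgebra ℂ A}
    [IsClosed (P : Set A)] (E : CondExpectation P) : Prop :=
  ∃ h : E.FiniteIndex, ∃ e : SeqAlg A, e ∈ centralSeq A ∧ IsStarProjection e ∧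
    seqMap (inclL P) (seqMap E.toMap e) * toSeqAlg (E.index h) = toSeqAlg 1 ∧
    toSeqAlg (E.index h) * seqMap (inclL P) (seqMap E.toMap e) = toSeqAlg 1 ∧
    Function.Injective fun x : A => toSeqAlg x * e

/-- `A ⊇ P` is a finite-index inclusion with the Rohlin property. -/
def IsRohlinInclusion {A : Type u} [CStarAlgebra A] (P : StarSubalgebra ℂ A)
    [IsClosed (P : Set A)] : Prop :=
  ∃ E : CondExpectation P, E.HasRohlinProperty

end

noncomputable section

/-! ### Projections in C*-algebras -/

/-! The Rohlin projection yields a unital *-homomorphism `β : A → P^∞` that is the canonical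
embedding on `P` (`IsRohlinInclusion.exists_hom`). Given finitely many elements of `P`, approximate
them in `A` by `φ(B)` with `B` in the finite saturation. If `β ∘ φ : B → P^∞` comes from
*-homomorphisms `θ n : B → P`, then, since `β` fixes `P` and is contractive, `θ n` for large `n`
approximates the same elements inside `P`, and it is unital because projections close to `1` equal
`1`.

The lifting (`liftsSequences_of_finiteSaturation`) rests on two facts. Every algebra in the finite
saturation is a corner of a finite direct sum of matrix algebras over members of the class, hence a
finite direct sum of corners of such matrix algebras, each zero or semiprojective. Semiprojectivity
lifts each summand, because `c₀(P)` is the closure of the increasing union of the ideals of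
sequences vanishing from some index on. The lifts of different summands are only asymptotically
orthogonal, and conjugation by partial isometries close to the unit projections makes them
orthogonal (`exists_represents_orthogonal`).

With `c = Index E`, the map is `β(a) = E^∞(c e a)`. It is multiplicative because of the identity `e
x = c e E^∞(e x)` (`mul_eq_index_mul_expectation`). The difference `T` of the two sides is a
self-adjoint idempotent for the `P^∞`-valued inner product `E^∞(x* y)`, and its trace `∑ T(uᵢ) vᵢ`
is zero. Positivity of the Gram matrix `E(uₖ* uⱼ)` turns this trace into a sum of terms `Y Y*`, so
`T = 0`. -/

theorem exists_inv_sqrt_near_one {A : Type*} [CStarAlgebra A] {y : A} (hy : IsSelfAdjoint y)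
    (h : ‖y - 1‖ ≤ 1 / 2) :
    ∃ z : A, IsSelfAdjoint z ∧ z * y * z = 1 ∧ (∀ x, Commute x y → star x = x → Commute x z) ∧
      ‖z - 1‖ ≤ 2 * ‖y - 1‖ := by
  have hspec : ∀ t ∈ spectrum ℝ y, |t - 1| ≤ ‖y - 1‖ := by
    intro t ht
    have h1 := norm_apply_le_norm_cfc (fun t : ℝ => t - 1) y ht
    have h2 : cfc (fun t : ℝ => t - 1) y = y - 1 := by
      rw [cfc_sub _ _ y, cfc_id' ℝ y, cfc_const_one ℝ y]
    rwa [h2] at h1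
  have hpos : ∀ t ∈ spectrum ℝ y, 1 / 2 ≤ t := by
    intro t ht
    have := abs_le.1 ((hspec t ht).trans h)
    linarith [this.1]
  have hc : ContinuousOn (fun t : ℝ => (√t)⁻¹) (spectrum ℝ y) := by
    refine ContinuousOn.inv₀ (by fun_prop) fun t ht => ?_
    have := hpos t ht
    exact (Real.sqrt_pos.2 (by linarith)).ne'
  -- `z` is `y^(-1/2)`; the spectrum of `y` lies in `[1/2, 3/2]`.
  refine ⟨cfc (fun t : ℝ => (√t)⁻¹) y, cfc_predicate _ y, ?_, ?_, ?_⟩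
  · nth_rw 2 [← cfc_id' ℝ y]
    rw [← cfc_mul _ _ y, ← cfc_mul _ _ y, ← cfc_const_one ℝ y]
    refine cfc_congr fun t ht => ?_
    have ht' := hpos t ht
    have hs : √t ≠ 0 := (Real.sqrt_pos.2 (by linarith)).ne'
    have := Real.mul_self_sqrt (show 0 ≤ t by linarith)
    change (√t)⁻¹ * t * (√t)⁻¹ = 1
    field_simp
    nlinarith
  · intro x hx hsx
    exact (Commute.cfc_real hx.symm _).symm
  · rw [← cfc_const_one ℝ y, ← cfc_sub _ _ y, cfc_const_one ℝ y]
    refine norm_cfc_le (by positivity) fun t ht => ?_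
    have ht' := hpos t ht
    have hs : 1 / 2 ≤ √t := by
      apply Real.le_sqrt_of_sq_le; nlinarith
    have hsq := Real.mul_self_sqrt (show 0 ≤ t by linarith)
    -- The constant 2 is a bound for `1 / (√t (1 + √t))`, since `√t ≥ 1/2`.
    have e : (√t)⁻¹ - 1 = -(t - 1) * (√t * (1 + √t))⁻¹ := by
      have : √t ≠ 0 := by linarith
      have : 1 + √t ≠ 0 := by linarith
      field_simp
      nlinarith
    rw [e, norm_mul, norm_neg, mul_comm]
    refine mul_le_mul ?_ (hspec t ht) (norm_nonneg _) (by norm_num)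
    rw [norm_inv, Real.norm_of_nonneg (by positivity)]
    rw [inv_le_comm₀ (by positivity) (by norm_num)]
    nlinarith

/-- A projection that is almost dominated by `q` is equivalent to one dominated by `q`, through a
partial isometry close to it. -/
theorem exists_partialIsometry_near {A : Type*} [CStarAlgebra A] {p q : A}
    (hp : IsStarProjection p) (hq : IsStarProjection q) (h : ‖q * p - p‖ ≤ 1 / 2) :
    ∃ v : A, star v * v = p ∧ q * v = v ∧ ‖v - p‖ ≤ 3 * ‖q * p - p‖ := by
  have hpp : p * p = p := hp.isIdempotentElem
  have hqq : q * q = q := hq.isIdempotentElem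
  have hps : star p = p := hp.isSelfAdjoint
  have hqs : star q = q := hq.isSelfAdjoint
  -- Adding `1 - p` turns `pqp`, nearly the unit of the corner at `p`, into an element near `1`. The
  -- partial isometry is then the polar part `q p y^(-1/2)` of `qp`.
  set y : A := p * q * p + (1 - p) with hy
  have hys : IsSelfAdjoint y := by
    simp [IsSelfAdjoint, hy, hps, hqs, mul_assoc]
  have hy1 : ‖y - 1‖ ≤ ‖q * p - p‖ := by
    have e : y - 1 = p * (q * p - p) := by
      rw [hy, mul_sub, hpp, mul_assoc]; abel
    rw [e]
    refine (norm_mul_le _ _).trans ?_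
    exact mul_le_of_le_one_left (norm_nonneg _) hp.norm_le
  obtain ⟨z, hz, hzyz, hcomm, hz1⟩ := exists_inv_sqrt_near_one hys (hy1.trans h)
  have hpy : p * y = p * q * p := by
    rw [hy, mul_add, mul_sub, mul_one, hpp, ← mul_assoc, ← mul_assoc, hpp]; abel
  have hyp : y * p = p * q * p := by
    rw [hy, add_mul, sub_mul, one_mul, hpp, mul_assoc, hpp]; abel
  have hpz : p * z = z * p := hcomm p (show p * y = y * p by rw [hpy, hyp]) hps
  refine ⟨q * p * z, ?_, by simp only [← mul_assoc, hqq], ?_⟩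
  · calc star (q * p * z) * (q * p * z) = z * (p * (q * q) * p) * z := by
          simp only [star_mul, hps, hqs, hz.star_eq, mul_assoc]
      _ = p * (z * y * z) := by
          rw [hqq, ← hpy, ← mul_assoc, ← hpz]; simp only [mul_assoc]
      _ = p := by rw [hzyz, mul_one]
  · have e : q * p * z - p = q * p * (z - 1) + (q * p - p) := by
      rw [mul_sub, mul_one]; abel
    rw [e]
    have h1 : ‖q * p * (z - 1)‖ ≤ ‖z - 1‖ := by
      refine (norm_mul_le _ _).trans (mul_le_of_le_one_left (norm_nonneg _) ?_)
      exact (norm_mul_le _ _).trans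
        (mul_le_one₀ hq.norm_le (norm_nonneg _) hp.norm_le)
    linarith [norm_add_le (q * p * (z - 1)) (q * p - p)]

/-! ### Sequences of *-homomorphisms representing a map into the sequence algebra -/

theorem toSeqAlg_mul {A : Type u} [CStarAlgebra A] (a b : A) :
    toSeqAlg (a * b) = toSeqAlg a * toSeqAlg b := rfl

theorem quotMk_c0_eq_iff {A : Type u} [CStarAlgebra A] {f g : BddSeq A} :
    (c0Ideal A).quotMk f = (c0Ideal A).quotMk g ↔ Tendsto (fun n => f n - g n) atTop (𝓝 0) := by
  refine ((c0Ideal A).toQuot_eq_iff).trans ?_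
  rw [tendsto_zero_iff_norm_tendsto_zero]
  rfl

/-- The bounded sequence `n ↦ θ n a`. -/
def seqOfHoms {X P : Type u} [NonUnitalCStarAlgebra X] [CStarAlgebra P]
    (θ : ℕ → X →⋆ₙₐ[ℂ] P) (a : X) : BddSeq P :=
  ⟨fun n => θ n a, memℓp_infty ⟨‖a‖, by
    rintro _ ⟨n, rfl⟩
    exact NonUnitalStarAlgHom.norm_apply_le (θ n) a⟩⟩

/-- The *-homomorphisms `θ n` represent the map `φ` into the sequence algebra. -/
def Represents {X P : Type u} [NonUnitalCStarAlgebra X] [CStarAlgebra P]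
    (θ : ℕ → X →⋆ₙₐ[ℂ] P) (φ : X →⋆ₙₐ[ℂ] SeqAlg P) : Prop :=
  ∀ a, (c0Ideal P).quotMk (seqOfHoms θ a) = φ a

/-- Every *-homomorphism from `X` to a sequence algebra comes from a sequence of
*-homomorphisms. -/
def LiftsSequences (X : Type u) [NonUnitalCStarAlgebra X] : Prop :=
  ∀ (P : Type u) [CStarAlgebra P] (φ : X →⋆ₙₐ[ℂ] SeqAlg P),
    ∃ θ : ℕ → X →⋆ₙₐ[ℂ] P, Represents θ φ

/-- The ideal of sequences vanishing from the index `n` on. -/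
def vanishFromIdeal (P : Type u) [CStarAlgebra P] (n : ℕ) : CStarIdeal (BddSeq P) where
  carrier := {f | ∀ k, n ≤ k → f k = 0}
  zero_mem' := fun _ _ => rfl
  add_mem' := by
    intro f g hf hg k hk
    simp [hf k hk, hg k hk]
  smul_mem' := by
    intro c f hf k hk
    simp [hf k hk]
  mul_mem_left' := by
    intro b f hf k hk
    simp [hf k hk]
  mul_mem_right' := by
    intro f b hf k hk
    simp [hf k hk]
  star_mem' := by
    intro f hf k hk
    simp [hf k hk]
  isClosed' := by
    have : {f : BddSeq P | ∀ k, n ≤ k → f k = 0} = ⋂ k, ⋂ _ : n ≤ k, {f | f k = 0} := by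
      ext f; simp
    rw [this]
    refine isClosed_iInter fun k => isClosed_iInter fun _ => isClosed_eq ?_ continuous_const
    exact (continuous_apply k).comp (lp.uniformContinuous_coe.continuous)

theorem isIncreasingLimit_vanishFromIdeal (P : Type u) [CStarAlgebra P] :
    CStarIdeal.IsIncreasingLimit (vanishFromIdeal P) (c0Ideal P) where
  mono m n hmn f hf k hk := hf k (hmn.trans hk)
  closure_eq := by
    refine Set.Subset.antisymm ?_ fun f hf => ?_
    · refine closure_minimal (Set.iUnion_subset fun n f hf => ?_) (c0Ideal P).isClosed'
      refine tendsto_const_nhds.congr' ?_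
      filter_upwards [eventually_ge_atTop n] with k hk
      rw [hf k hk, norm_zero]
    · rw [Metric.mem_closure_iff]
      intro ε hε
      have hf' : Tendsto (fun n => ‖f n‖) atTop (𝓝 0) := hf
      obtain ⟨N, hN⟩ := Metric.tendsto_atTop.1 hf' (ε / 2) (half_pos hε)
      -- Truncating a null sequence after its large terms approximates it uniformly.
      let g : BddSeq P := ⟨fun k => if k < N then f k else 0, memℓp_infty ⟨‖f‖, by
        rintro _ ⟨k, rfl⟩
        dsimp only
        split_ifs
        · exact lp.norm_apply_le_norm (by simp) f k
        · simp⟩⟩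
      refine ⟨g, Set.mem_iUnion.2 ⟨N, fun k hk => if_neg (not_lt.2 hk)⟩, ?_⟩
      rw [dist_eq_norm]
      refine lt_of_le_of_lt (lp.norm_le_of_forall_le (half_pos hε).le fun k => ?_)
        (half_lt_self hε)
      change ‖f k - (if k < N then f k else 0)‖ ≤ ε / 2
      split_ifs with h
      · simpa using (half_pos hε).le
      · have := hN k (not_lt.1 h)
        rw [dist_zero_right, norm_norm] at this
        simpa using this.le

/-- Evaluation of a bounded sequence at `k`. -/
def evalBddSeq (P : Type u) [CStarAlgebra P] (k : ℕ) : BddSeq P →ₗ[ℂ] P where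
  toFun f := f k
  map_add' _ _ := rfl
  map_smul' _ _ := rfl

/-- Evaluation at `k ≥ n` of a class modulo the sequences vanishing from `n` on. -/
def vanishFromEval (P : Type u) [CStarAlgebra P] (n k : ℕ) (h : n ≤ k) :
    (vanishFromIdeal P n).Quotient →⋆ₙₐ[ℂ] P where
  toFun := (vanishFromIdeal P n).toSubmodule.liftQ (evalBddSeq P k) (fun _ hf => hf k h)
  map_smul' c x := ((vanishFromIdeal P n).toSubmodule.liftQ (evalBddSeq P k) _).map_smul c x
  map_zero' := ((vanishFromIdeal P n).toSubmodule.liftQ (evalBddSeq P k) _).map_zero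
  map_add' x y := ((vanishFromIdeal P n).toSubmodule.liftQ (evalBddSeq P k) _).map_add x y
  map_mul' x y := by
    obtain ⟨f, rfl⟩ := (vanishFromIdeal P n).toQuot_surjective x
    obtain ⟨g, rfl⟩ := (vanishFromIdeal P n).toQuot_surjective y
    rfl
  map_star' x := by
    obtain ⟨f, rfl⟩ := (vanishFromIdeal P n).toQuot_surjective x
    rfl

/-- Apply semiprojectivity to `ℓ^∞(P)` and the ideals of sequences vanishing from `n` on. A lift
modulo such an ideal can be evaluated at every coordinate `k ≥ n`; the finitely many earlier
coordinates get the zero map, which does not change the class modulo `c₀`. -/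
theorem IsSemiprojective.liftsSequences {X : Type u} [NonUnitalCStarAlgebra X]
    (hX : IsSemiprojective X) : LiftsSequences X := by
  intro P _ φ
  obtain ⟨n, ψ, hψ⟩ := hX (BddSeq P) (vanishFromIdeal P) (c0Ideal P)
    (isIncreasingLimit_vanishFromIdeal P) φ
  refine ⟨fun k => if h : n ≤ k then (vanishFromEval P n k h).comp ψ else 0, fun a => ?_⟩
  rw [← hψ a]
  obtain ⟨f, hf⟩ := (vanishFromIdeal P n).toQuot_surjective (ψ a)
  rw [← hf]
  change _ = (c0Ideal P).quotMk f
  rw [quotMk_c0_eq_iff]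
  refine tendsto_const_nhds.congr' ?_
  filter_upwards [eventually_ge_atTop n] with k hk
  have : seqOfHoms (fun k => if h : n ≤ k then (vanishFromEval P n k h).comp ψ else 0) a k
      = f k := by
    change (if h : n ≤ k then (vanishFromEval P n k h).comp ψ else 0) a = f k
    rw [dif_pos hk, NonUnitalStarAlgHom.comp_apply, ← hf]
    rfl
  rw [this, sub_self]

/-! ### Making families of *-homomorphisms orthogonal -/

theorem Represents.congr {X P : Type u} [NonUnitalCStarAlgebra X] [CStarAlgebra P]
    {θ θ' : ℕ → X →⋆ₙₐ[ℂ] P} {φ : X →⋆ₙₐ[ℂ] SeqAlg P} (h : Represents θ φ)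
    (h' : ∀ a, Tendsto (fun n => θ' n a - θ n a) atTop (𝓝 0)) : Represents θ' φ :=
  fun a => (quotMk_c0_eq_iff.2 (h' a)).trans (h a)

theorem Represents.tendsto_mul {X Y P : Type u} [NonUnitalCStarAlgebra X]
    [NonUnitalCStarAlgebra Y] [CStarAlgebra P]
    {θ : ℕ → X →⋆ₙₐ[ℂ] P} {φ : X →⋆ₙₐ[ℂ] SeqAlg P} (h : Represents θ φ)
    {η : ℕ → Y →⋆ₙₐ[ℂ] P} {ψ : Y →⋆ₙₐ[ℂ] SeqAlg P} (h' : Represents η ψ) {x : X} {y : Y}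
    (hxy : φ x * ψ y = 0) : Tendsto (fun n => θ n x * η n y) atTop (𝓝 0) := by
  rw [← h x, ← h' y, ← map_mul, ← map_zero (c0Ideal P).quotMk, quotMk_c0_eq_iff] at hxy
  refine hxy.congr fun n => ?_
  exact sub_zero _

/-- The *-homomorphism `a ↦ v θ(a) v*`. -/
def conjStarHom {X P : Type u} [CStarAlgebra X] [CStarAlgebra P] (θ : X →⋆ₙₐ[ℂ] P) (v : P)
    (hv : star v * v = θ 1 ∨ v = 0) : X →⋆ₙₐ[ℂ] P where
  toFun a := v * θ a * star v
  map_smul' c a := by simp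
  map_zero' := by simp
  map_add' a b := by simp [mul_add, add_mul]
  map_mul' a b := by
    rcases hv with hv | rfl
    · calc v * θ (a * b) * star v = v * (θ a * θ 1 * θ b) * star v := by
            rw [← map_mul, ← map_mul, mul_one]
        _ = _ := by rw [← hv]; simp only [mul_assoc]
    · simp
  map_star' a := by simp [map_star, mul_assoc]

theorem conjHom_apply {X P : Type u} [CStarAlgebra X] [CStarAlgebra P] (θ : X →⋆ₙₐ[ℂ] P) (v : P)
    (hv : star v * v = θ 1 ∨ v = 0) (a : X) : conjStarHom θ v hv a = v * θ a * star v := rfl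

theorem isStarProjection_map_one {X P : Type u} [CStarAlgebra X] [CStarAlgebra P]
    (θ : X →⋆ₙₐ[ℂ] P) : IsStarProjection (θ 1) :=
  ⟨by rw [IsIdempotentElem, ← map_mul, mul_one], by rw [IsSelfAdjoint, ← map_star, star_one]⟩

/-- With `d = v - θ(1)`, every term of `v θ(a) v* - θ(a)` contains a factor `d` or `d*`, so the
perturbation vanishes modulo `c₀`. -/
theorem Represents.conj {X P : Type u} [CStarAlgebra X] [CStarAlgebra P]
    {θ : ℕ → X →⋆ₙₐ[ℂ] P} {φ : X →⋆ₙₐ[ℂ] SeqAlg P} (h : Represents θ φ) (v : ℕ → P)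
    (hv : ∀ n, star (v n) * v n = θ n 1 ∨ v n = 0)
    (ht : Tendsto (fun n => v n - θ n 1) atTop (𝓝 0)) :
    Represents (fun n => conjStarHom (θ n) (v n) (hv n)) φ := by
  refine h.congr fun a => ?_
  have ht' := tendsto_zero_iff_norm_tendsto_zero.1 ht
  refine squeeze_zero_norm (a := fun n => 2 * ‖v n - θ n 1‖ * ‖a‖ +
    ‖v n - θ n 1‖ * ‖a‖ * ‖v n - θ n 1‖) (fun n => ?_) ?_
  · have ha := NonUnitalStarAlgHom.norm_apply_le (θ n) a
    set d := v n - θ n 1 with hd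
    have e : conjStarHom (θ n) (v n) (hv n) a - θ n a
        = d * θ n a + θ n a * star d + d * θ n a * star d := by
      have h1 : θ n 1 * θ n a = θ n a := by rw [← map_mul, one_mul]
      have h2 : θ n a * θ n 1 = θ n a := by rw [← map_mul, mul_one]
      have h3 : star (θ n 1) = θ n 1 := by rw [← map_star, star_one]
      have h4 : v n = d + θ n 1 := by rw [hd, sub_add_cancel]
      rw [conjHom_apply, h4, star_add, h3, add_mul, h1, mul_add, add_mul, add_mul, h2,
        mul_assoc d (θ n a) (θ n 1), h2]
      abel
    have n1 : ‖d * θ n a‖ ≤ ‖d‖ * ‖a‖ :=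
      (norm_mul_le _ _).trans (mul_le_mul_of_nonneg_left ha (norm_nonneg _))
    have n2 : ‖θ n a * star d‖ ≤ ‖a‖ * ‖d‖ :=
      (norm_mul_le _ _).trans
        (by rw [norm_star]; exact mul_le_mul_of_nonneg_right ha (norm_nonneg _))
    have n3 : ‖d * θ n a * star d‖ ≤ ‖d‖ * ‖a‖ * ‖d‖ :=
      (norm_mul_le _ _).trans
        (by rw [norm_star]; exact mul_le_mul_of_nonneg_right n1 (norm_nonneg _))
    rw [e]
    linarith [norm_add₃_le (a := d * θ n a) (b := θ n a * star d) (c := d * θ n a * star d)]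
  · have := ((ht'.const_mul 2).mul_const ‖a‖).add ((ht'.mul_const ‖a‖).mul ht')
    simpa using this

theorem isStarProjection_sum {P ι : Type*} [CStarAlgebra P] (s : Finset ι) (p : ι → P)
    (hp : ∀ i, IsStarProjection (p i)) (h : ∀ i ∈ s, ∀ k ∈ s, i ≠ k → p i * p k = 0) :
    IsStarProjection (∑ i ∈ s, p i) := by
  classical
  refine ⟨?_, ?_⟩
  · rw [IsIdempotentElem, Finset.sum_mul]
    refine Finset.sum_congr rfl fun i hi => ?_
    rw [Finset.mul_sum, Finset.sum_eq_single_of_mem i hi fun k hk hki => h i hi k hk hki.symm]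
    exact (hp i).isIdempotentElem
  · rw [IsSelfAdjoint, star_sum]
    exact Finset.sum_congr rfl fun i _ => (hp i).isSelfAdjoint

/-- *-homomorphisms with orthogonal images, each represented by a sequence of *-homomorphisms, are
represented by sequences of *-homomorphisms whose images are orthogonal at each index. -/
theorem exists_represents_orthogonal {ι : Type*} {P : Type u} [Finite ι] [CStarAlgebra P] (X : ι → Type u)
    [∀ i, CStarAlgebra (X i)] (φ : ∀ i, X i →⋆ₙₐ[ℂ] SeqAlg P)
    (hφ : ∀ i k, i ≠ k → φ i 1 * φ k 1 = 0)
    (h : ∀ i, ∃ θ : ℕ → X i →⋆ₙₐ[ℂ] P, Represents θ (φ i)) :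
    ∃ θ : ∀ i, ℕ → X i →⋆ₙₐ[ℂ] P, (∀ i, Represents (θ i) (φ i)) ∧
      ∀ n i k, i ≠ k → θ i n 1 * θ k n 1 = 0 := by
  classical
  cases nonempty_fintype ι
  suffices H : ∀ s : Finset ι, ∃ θ : ∀ i, ℕ → X i →⋆ₙₐ[ℂ] P, (∀ i, Represents (θ i) (φ i)) ∧
      ∀ n, ∀ i ∈ s, ∀ k ∈ s, i ≠ k → θ i n 1 * θ k n 1 = 0 by
    obtain ⟨θ, h1, h2⟩ := H Finset.univ
    exact ⟨θ, h1, fun n i k => h2 n i (Finset.mem_univ i) k (Finset.mem_univ k)⟩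
  intro s
  induction s using Finset.induction_on with
  | empty =>
    choose θ hθ using h
    exact ⟨θ, hθ, by simp⟩
  | insert i₀ s hi₀ ih =>
    obtain ⟨θ, hθ, ho⟩ := ih
    -- The earlier maps are already orthogonal, so their unit projections add up to a projection
    -- `Q`. The new projection is asymptotically orthogonal to `Q`, so it can be moved under `1 - Q`
    -- by a small perturbation.
    have hQ : ∀ n, IsStarProjection (∑ k ∈ s, θ k n 1) := fun n =>
      isStarProjection_sum s _ (fun i => isStarProjection_map_one (θ i n)) (ho n)
    have hsmall : Tendsto (fun n => (1 - ∑ k ∈ s, θ k n 1) * θ i₀ n 1 - θ i₀ n 1) atTop (𝓝 0) := by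
      have h1 : Tendsto (fun n => -∑ k ∈ s, θ k n 1 * θ i₀ n 1) atTop (𝓝 0) := by
        have := (tendsto_finsetSum s fun k hk => (hθ k).tendsto_mul (hθ i₀)
          (hφ k i₀ (fun hki => hi₀ (hki ▸ hk)))).neg
        simpa using this
      refine h1.congr fun n => ?_
      rw [sub_mul, one_mul, Finset.sum_mul]; abel
    -- The choice `v = 0` serves the finitely many indices where the new projection is not yet close
    -- enough to `1 - Q`.
    have hv : ∀ n, ∃ v : P, (star v * v = θ i₀ n 1 ∨ v = 0) ∧
        (1 - ∑ k ∈ s, θ k n 1) * v = v ∧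
        (‖(1 - ∑ k ∈ s, θ k n 1) * θ i₀ n 1 - θ i₀ n 1‖ ≤ 1 / 2 → ‖v - θ i₀ n 1‖ ≤
          3 * ‖(1 - ∑ k ∈ s, θ k n 1) * θ i₀ n 1 - θ i₀ n 1‖) := by
      intro n
      by_cases hn : ‖(1 - ∑ k ∈ s, θ k n 1) * θ i₀ n 1 - θ i₀ n 1‖ ≤ 1 / 2
      · obtain ⟨v, h1, h2, h3⟩ := exists_partialIsometry_near (isStarProjection_map_one (θ i₀ n))
          (hQ n).one_sub hn
        exact ⟨v, Or.inl h1, h2, fun _ => h3⟩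
      · exact ⟨0, Or.inr rfl, by simp, fun h => absurd h hn⟩
    choose v hv1 hv2 hv3 using hv
    have hvt : Tendsto (fun n => v n - θ i₀ n 1) atTop (𝓝 0) := by
      have hsn := tendsto_zero_iff_norm_tendsto_zero.1 hsmall
      have h3 := hsn.const_mul 3
      rw [mul_zero] at h3
      refine squeeze_zero_norm' ?_ h3
      filter_upwards [hsn.eventually (ge_mem_nhds (show (0 : ℝ) < 1 / 2 by norm_num))] with n hn
      exact hv3 n hn
    have hort : ∀ n, ∀ k ∈ s, θ k n 1 * v n = 0 := by
      intro n k hk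
      have h0 : θ k n 1 * (1 - ∑ l ∈ s, θ l n 1) = 0 := by
        rw [mul_sub, mul_one, Finset.mul_sum,
          Finset.sum_eq_single_of_mem k hk fun l hl hlk => ho n k hk l hl hlk.symm,
          (isStarProjection_map_one (θ k n)).isIdempotentElem.eq, sub_self]
      rw [← hv2 n, ← mul_assoc, h0, zero_mul]
    have hort' : ∀ n, ∀ k ∈ s, star (v n) * θ k n 1 = 0 := by
      intro n k hk
      have := congrArg star (hort n k hk)
      rwa [star_mul, star_zero, (isStarProjection_map_one (θ k n)).isSelfAdjoint.star_eq] at this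
    refine ⟨Function.update θ i₀ fun n => conjStarHom (θ i₀ n) (v n) (hv1 n), fun i => ?_, ?_⟩
    · by_cases hi : i = i₀
      · subst hi
        rw [Function.update_self]
        exact (hθ i).conj v hv1 hvt
      · rw [Function.update_of_ne hi]
        exact hθ i
    · intro n i hi k hk hik
      by_cases hi0 : i = i₀
      · subst hi0
        have hks : k ∈ s := (Finset.mem_insert.1 hk).resolve_left (Ne.symm hik)
        rw [Function.update_self, Function.update_of_ne (Ne.symm hik), conjHom_apply, mul_assoc,
          hort' n k hks, mul_zero]
      · have his : i ∈ s := (Finset.mem_insert.1 hi).resolve_left hi0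
        by_cases hk0 : k = i₀
        · subst hk0
          rw [Function.update_self, Function.update_of_ne hik, conjHom_apply, ← mul_assoc,
            ← mul_assoc, hort n i his, zero_mul, zero_mul]
        · rw [Function.update_of_ne hi0, Function.update_of_ne hk0]
          exact ho n i his k ((Finset.mem_insert.1 hk).resolve_left hk0) hik

/-! ### Structure of the finite saturation -/

/-- `B` is a corner of a finite direct sum of matrix algebras over members of `𝒞`. -/
def CStarClass.IsCornerOfMatrixSum (𝒞 : CStarClass.{u}) : CStarClass.{u} := fun B _ =>
  ∃ (ι : Type) (_ : Fintype ι) (A : ι → Type u) (_ : ∀ i, CStarAlgebra (A i)) (m : ι → ℕ)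
    (j : B →⋆ₙₐ[ℂ] ∀ i, CStarMatrix (Fin (m i)) (Fin (m i)) (A i)),
    (∀ i, 𝒞 (A i)) ∧ Function.Injective j ∧ ∀ x, j 1 * x * j 1 = x → ∃ b, j b = x

/-- The `nm × nm` matrix with prescribed `m × m` blocks. -/
def ofBlocks {A : Type*} {n m : ℕ} (F : Fin n → Fin n → CStarMatrix (Fin m) (Fin m) A) :
    CStarMatrix (Fin (n * m)) (Fin (n * m)) A :=
  CStarMatrix.ofMatrix fun a b =>
    F (finProdFinEquiv.symm a).1 (finProdFinEquiv.symm b).1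
      (finProdFinEquiv.symm a).2 (finProdFinEquiv.symm b).2

theorem ofBlocks_apply {A : Type*} {n m : ℕ} (F : Fin n → Fin n → CStarMatrix (Fin m) (Fin m) A)
    (r s : Fin n) (a b : Fin m) :
    ofBlocks F (finProdFinEquiv (r, a)) (finProdFinEquiv (s, b)) = F r s a b := by
  change F (finProdFinEquiv.symm (finProdFinEquiv (r, a))).1 _ _ _ = _
  simp only [Equiv.symm_apply_apply]

theorem ext_blocks {A : Type*} {n m : ℕ} {M N : CStarMatrix (Fin (n * m)) (Fin (n * m)) A}
    (h : ∀ r a s b, M (finProdFinEquiv (r, a)) (finProdFinEquiv (s, b))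
      = N (finProdFinEquiv (r, a)) (finProdFinEquiv (s, b))) : M = N := by
  ext a b
  obtain ⟨⟨r, a⟩, rfl⟩ := finProdFinEquiv.surjective a
  obtain ⟨⟨s, b⟩, rfl⟩ := finProdFinEquiv.surjective b
  exact h r a s b

theorem ofBlocks_injective {A : Type*} {n m : ℕ} :
    Function.Injective (ofBlocks (A := A) (n := n) (m := m)) := by
  intro F G h
  ext r s a b
  rw [← ofBlocks_apply F, h, ofBlocks_apply]

theorem ofBlocks_surjective {A : Type*} {n m : ℕ} :
    Function.Surjective (ofBlocks (A := A) (n := n) (m := m)) := fun M =>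
  ⟨fun r s => CStarMatrix.ofMatrix fun a b =>
    M (finProdFinEquiv (r, a)) (finProdFinEquiv (s, b)),
    ext_blocks fun r a s b => ofBlocks_apply _ r s a b⟩

theorem ofBlocks_mul {A : Type*} [NonUnitalSemiring A] {n m : ℕ}
    (F G : Fin n → Fin n → CStarMatrix (Fin m) (Fin m) A) :
    ofBlocks F * ofBlocks G = ofBlocks fun r s => ∑ t, F r t * G t s := by
  refine ext_blocks fun r a s b => ?_
  have hsum : ∀ (f : Fin n → CStarMatrix (Fin m) (Fin m) A), (∑ t, f t) a b = ∑ t, f t a b :=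
    fun f => Matrix.sum_apply a b Finset.univ f
  rw [ofBlocks_apply, hsum, CStarMatrix.mul_apply, ← finProdFinEquiv.sum_comp,
    Fintype.sum_prod_type]
  refine Finset.sum_congr rfl fun t _ => ?_
  rw [CStarMatrix.mul_apply]
  exact Finset.sum_congr rfl fun c _ => by rw [ofBlocks_apply, ofBlocks_apply]

/-- Entrywise application of a *-homomorphism `B → ∏ Mₘᵢ(Aᵢ)` to matrices over `B`. -/
def matrixBlockHom {B : Type u} [CStarAlgebra B] {ι : Type} {A : ι → Type u}
    [∀ i, CStarAlgebra (A i)] {m : ι → ℕ} (n : ℕ)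
    (j : B →⋆ₙₐ[ℂ] ∀ i, CStarMatrix (Fin (m i)) (Fin (m i)) (A i)) :
    CStarMatrix (Fin n) (Fin n) B →⋆ₙₐ[ℂ]
      ∀ i, CStarMatrix (Fin (n * m i)) (Fin (n * m i)) (A i) where
  toFun M i := ofBlocks fun r s => j (M r s) i
  map_smul' c M := by
    ext i : 1
    refine ext_blocks fun r a s b => ?_
    simp only [MonoidHom.id_apply, Pi.smul_apply, CStarMatrix.smul_apply, ofBlocks_apply, map_smul]
  map_zero' := by
    ext i : 1
    refine ext_blocks fun r a s b => ?_
    simp only [Pi.zero_apply, CStarMatrix.zero_apply, ofBlocks_apply, map_zero]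
  map_add' M N := by
    ext i : 1
    refine ext_blocks fun r a s b => ?_
    simp only [Pi.add_apply, CStarMatrix.add_apply, ofBlocks_apply, map_add]
  map_mul' M N := by
    ext i : 1
    simp only [Pi.mul_apply, ofBlocks_mul, CStarMatrix.mul_apply, map_sum, map_mul,
      Finset.sum_apply]
  map_star' M := by
    ext i : 1
    refine ext_blocks fun r a s b => ?_
    simp only [Pi.star_apply, CStarMatrix.star_apply, ofBlocks_apply, map_star]

theorem CStarClass.isCornerOfMatrixSum_of_mem (𝒞 : CStarClass.{u}) (A : Type u) [CStarAlgebra A]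
    (hA : 𝒞 A) : 𝒞.IsCornerOfMatrixSum A := by
  refine ⟨Unit, inferInstance, fun _ => A, fun _ => inferInstance, fun _ => 1,
    { toFun := fun a _ => CStarMatrix.ofMatrix fun _ _ => a
      map_smul' := fun c a => rfl
      map_zero' := rfl
      map_add' := fun a b => rfl
      map_mul' := fun a b => ?_
      map_star' := fun a => rfl }, fun _ => hA, ?_, ?_⟩
  · ext i r s
    exact (Fin.sum_univ_one fun _ : Fin 1 => a * b).symm
  · intro a b hab
    exact congrFun (congrFun (congrFun hab ()) 0) 0
  · intro x _
    refine ⟨x () 0 0, ?_⟩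
    ext i r s
    rw [Subsingleton.elim r 0, Subsingleton.elim s 0]
    rfl

/-- Direct sums join the index sets, `Mₙ` of a matrix algebra is a larger matrix algebra by
re-blocking, and a corner of a corner is a corner. Minimality of the finite saturation then puts all
its members in this form. -/
theorem CStarClass.isFinitelySaturated_isCornerOfMatrixSum (𝒞 : CStarClass.{u}) :
    𝒞.IsCornerOfMatrixSum.IsFinitelySaturated where
  of_iso A B _ _ := by
    rintro ⟨ι, _, X, _, m, j, hX, hj, hr⟩ ⟨f⟩
    refine ⟨ι, inferInstance, X, inferInstance, m, j.comp (f : B →⋆ₙₐ[ℂ] A), hX,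
      hj.comp f.injective, fun x hx => ?_⟩
    have h1 : j.comp (f : B →⋆ₙₐ[ℂ] A) 1 = j 1 := congrArg j (map_one f)
    rw [h1] at hx
    obtain ⟨a, ha⟩ := hr x hx
    exact ⟨f.symm a, by rw [← ha]; exact congrArg j (f.apply_symm_apply a)⟩
  directSum n _ B _ hB := by
    choose ι hι X hX m j hX' hj hr using hB
    refine ⟨Σ k, ι k, inferInstance, fun i => X i.1 i.2, fun i => inferInstance,
      fun i => m i.1 i.2,
      { toFun := fun b i => j i.1 (b i.1) i.2
        map_smul' := fun c b => ?_
        map_zero' := ?_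
        map_add' := fun a b => ?_
        map_mul' := fun a b => ?_
        map_star' := fun a => ?_ }, fun i => hX' i.1 i.2, ?_, ?_⟩
    · ext i : 1; simp
    · ext i : 1; simp
    · ext i : 1; simp
    · ext i : 1; simp
    · ext i : 1; simp [map_star]
    · intro a b hab
      ext k
      apply hj k
      ext i : 1
      exact congrFun hab ⟨k, i⟩
    · intro x hx
      have h : ∀ k, ∃ b, j k b = fun i => x ⟨k, i⟩ := fun k =>
        hr k _ (by ext i : 1; exact congrFun hx ⟨k, i⟩)
      choose b hb using h
      refine ⟨b, ?_⟩
      ext i : 1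
      exact congrFun (hb i.1) i.2
  matrix B _ n _ := by
    rintro ⟨ι, _, X, _, m, j, hX, hj, hr⟩
    refine ⟨ι, inferInstance, X, inferInstance, fun i => n * m i, matrixBlockHom n j, hX, ?_, ?_⟩
    · intro M N hMN
      ext r s
      apply hj
      ext i : 1
      have h : (ofBlocks fun r s => j (M r s) i) = ofBlocks fun r s => j (N r s) i := congrFun hMN i
      exact congrFun (congrFun (ofBlocks_injective h) r) s
    · intro x hx
      choose Y hY using fun i => ofBlocks_surjective (x i)
      have h1 : ∀ i, matrixBlockHom n j 1 i = ofBlocks fun r s => if r = s then j 1 i else 0 := by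
        intro i
        change (ofBlocks fun r s => j ((1 : CStarMatrix (Fin n) (Fin n) B) r s) i) = _
        congr 1
        ext r s : 2
        rw [CStarMatrix.one_apply]
        split_ifs
        · rfl
        · rw [map_zero]; rfl
      -- The image of the unit is block diagonal with blocks `j 1`, so compression by it acts on
      -- each block separately.
      have hY' : ∀ r s, (j 1 * (fun i => Y i r s) * j 1 : ∀ i, _) = fun i => Y i r s := by
        intro r s
        ext i : 1
        have hxi := congrFun hx i
        simp only [Pi.mul_apply] at hxi ⊢
        rw [← hY i, h1, ofBlocks_mul, ofBlocks_mul] at hxi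
        have := congrFun (congrFun (ofBlocks_injective hxi) r) s
        simpa using this
      choose b hb using fun r s => hr _ (hY' r s)
      refine ⟨CStarMatrix.ofMatrix b, ?_⟩
      ext i : 1
      rw [← hY i]
      change (ofBlocks fun r s => j (b r s) i) = _
      congr 1
      ext r s : 2
      rw [hb]
  corner B _ p hp _ := by
    rintro ⟨ι, _, X, _, m, j, hX, hj, hr⟩
    refine ⟨ι, inferInstance, X, inferInstance, m,
      { toFun := fun b => j b.1
        map_smul' := fun c b => map_smul j c b.1
        map_zero' := map_zero j
        map_add' := fun a b => map_add j a.1 b.1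
        map_mul' := fun a b => map_mul j a.1 b.1
        map_star' := fun a => map_star j a.1 }, hX, ?_, ?_⟩
    · intro a b hab
      exact Subtype.ext (hj hab)
    · intro x hx
      change j p * x * j p = x at hx
      have h1 : j 1 * x * j 1 = x := by
        rw [← hx]
        calc j 1 * (j p * x * j p) * j 1 = (j 1 * j p) * x * (j p * j 1) := by
              simp only [mul_assoc]
          _ = _ := by rw [← map_mul, ← map_mul, one_mul, mul_one]
      obtain ⟨b, hb⟩ := hr x h1
      refine ⟨⟨p * b * p, b, rfl⟩, ?_⟩
      change j (p * b * p) = x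
      rw [map_mul, map_mul, hb, hx]

theorem CStarClass.isCornerOfMatrixSum_of_finiteSaturation {𝒞 : CStarClass.{u}} {B : Type u}
    [CStarAlgebra B] (hB : 𝒞.finiteSaturation B) : 𝒞.IsCornerOfMatrixSum B :=
  hB _ 𝒞.isFinitelySaturated_isCornerOfMatrixSum 𝒞.isCornerOfMatrixSum_of_mem

/-! ### Lifting from the finite saturation -/

/-- The sum of *-homomorphisms with orthogonal images, composed with *-homomorphisms `π k`. -/
def sumHom {ι : Type*} [Fintype ι] {B P : Type u} [CStarAlgebra B] [CStarAlgebra P]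
    {X : ι → Type u} [∀ k, CStarAlgebra (X k)] (π : ∀ k, B →⋆ₙₐ[ℂ] X k)
    (θ : ∀ k, X k →⋆ₙₐ[ℂ] P) (h : ∀ i k, i ≠ k → θ i 1 * θ k 1 = 0) : B →⋆ₙₐ[ℂ] P where
  toFun b := ∑ k, θ k (π k b)
  map_smul' c b := by simp [Finset.smul_sum]
  map_zero' := by simp
  map_add' a b := by simp [Finset.sum_add_distrib]
  map_mul' a b := by
    classical
    rw [Finset.sum_mul]
    refine Finset.sum_congr rfl fun i _ => ?_
    rw [Finset.mul_sum, Finset.sum_eq_single i, map_mul, map_mul]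
    · intro k _ hki
      calc θ i (π i a) * θ k (π k b) = θ i (π i a * 1) * θ k (1 * π k b) := by
            rw [mul_one, one_mul]
        _ = θ i (π i a) * (θ i 1 * θ k 1) * θ k (π k b) := by
            rw [map_mul, map_mul]; simp only [mul_assoc]
        _ = 0 := by rw [h i k hki.symm, mul_zero, zero_mul]
    · simp
  map_star' a := by simp [map_star]

/-- The coordinates of the projection `j 1` split `B` into a direct sum of corners of matrix
algebras over members of the class. Each summand lifts, the lifts are made orthogonal, and their sum
is a *-homomorphism on `B`. -/
theorem liftsSequences_of_finiteSaturation {𝒞 : CStarClass.{u}} (hflex : 𝒞.IsFlexible)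
    {B : Type u} [CStarAlgebra B] (hB : 𝒞.finiteSaturation B) : LiftsSequences B := by
  classical
  obtain ⟨ι, _, A, _, m, j, hA, hj, hr⟩ := CStarClass.isCornerOfMatrixSum_of_finiteSaturation hB
  intro P _ φ
  have hp : ∀ k, IsStarProjection (j 1 k) := fun k =>
    ⟨by
      have : j 1 * j 1 = j 1 := by rw [← map_mul, mul_one]
      exact congrFun this k, by
      have : star (j 1) = j 1 := by rw [← map_star, star_one]
      exact congrFun this k⟩
  -- `κ k` embeds the `k`-th corner as a direct summand of `B`; it exists because `j` maps onto the
  -- whole corner at `j 1`.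
  have hκ : ∀ k, ∃ κ : Corner (j 1 k) (hp k) →⋆ₙₐ[ℂ] B, ∀ x, j (κ x) = Pi.single k x.1 := by
    intro k
    have h : ∀ x : Corner (j 1 k) (hp k), ∃ b, j b = Pi.single k x.1 := by
      intro x
      refine hr _ ?_
      have hx := mem_cornerSubalgebra_iff.1 x.2
      ext i : 1
      by_cases hi : i = k
      · subst hi
        simp only [Pi.mul_apply, Pi.single_eq_same]
        rw [hx.1, hx.2]
      · simp [Pi.single_eq_of_ne hi]
    choose κ hκ using h
    refine ⟨{ toFun := κ, map_smul' := fun c x => hj ?_, map_zero' := hj ?_,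
              map_add' := fun x y => hj ?_, map_mul' := fun x y => hj ?_,
              map_star' := fun x => hj ?_ }, hκ⟩
    · rw [hκ]
      change _ = j (c • κ x)
      rw [map_smul, hκ]
      exact Pi.single_smul (f := fun i => CStarMatrix (Fin (m i)) (Fin (m i)) (A i)) k c x.1
    · rw [hκ, map_zero]
      exact Pi.single_zero k
    · change j (κ (x + y)) = j (κ x + κ y)
      rw [map_add, hκ, hκ, hκ]
      exact Pi.single_add (f := fun i => CStarMatrix (Fin (m i)) (Fin (m i)) (A i)) k x.1 y.1
    · change j (κ (x * y)) = j (κ x * κ y)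
      rw [map_mul, hκ, hκ, hκ]
      exact Pi.single_mul (α := fun i => CStarMatrix (Fin (m i)) (Fin (m i)) (A i)) k x.1 y.1
    · rw [map_star, hκ, hκ]
      exact Pi.single_star (f := fun i => CStarMatrix (Fin (m i)) (Fin (m i)) (A i)) k x.1
  choose κ hκ using hκ
  let π : ∀ k, B →⋆ₙₐ[ℂ] Corner (j 1 k) (hp k) := fun k =>
    { toFun := fun b => ⟨j b k, mem_cornerSubalgebra_iff.2
        ⟨by
          have : j 1 * j b = j b := by rw [← map_mul, one_mul]
          exact congrFun this k, by
          have : j b * j 1 = j b := by rw [← map_mul, mul_one]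
          exact congrFun this k⟩⟩
      map_smul' := fun c b => Subtype.ext (congrFun (map_smul j c b) k)
      map_zero' := Subtype.ext (congrFun (map_zero j) k)
      map_add' := fun a b => Subtype.ext (congrFun (map_add j a b) k)
      map_mul' := fun a b => Subtype.ext (congrFun (map_mul j a b) k)
      map_star' := fun a => Subtype.ext (congrFun (map_star j a) k) }
  have hsum : ∀ b, ∑ k, κ k (π k b) = b := by
    intro b
    apply hj
    rw [map_sum]
    simp only [hκ]
    exact Finset.univ_sum_single (j b)
  have hlift : ∀ k, LiftsSequences (Corner (j 1 k) (hp k)) := by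
    intro k
    -- Flexibility speaks only of nonzero projections; for a zero coordinate the corner is the zero
    -- algebra.
    by_cases h0 : j 1 k = 0
    · intro Q _ ψ
      have hz : ∀ a : Corner (j 1 k) (hp k), a = 0 := by
        intro a
        refine Subtype.ext ?_
        have ha := (mem_cornerSubalgebra_iff.1 a.2).1
        exact ha.symm.trans ((congrArg (· * a.1) h0).trans (zero_mul _))
      refine ⟨fun _ => 0, fun a => ?_⟩
      rw [hz a, map_zero]
      exact map_zero (c0Ideal Q).quotMk
    · exact (hflex.corner (A k) (hA k) (m k) (j 1 k) (hp k) h0).1.liftsSequences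
  obtain ⟨θ, hθ, ho⟩ := exists_represents_orthogonal (fun k => Corner (j 1 k) (hp k))
    (fun k => φ.comp (κ k)) (fun i k hik => by
      have : κ i 1 * κ k 1 = 0 := by
        apply hj
        rw [map_mul, hκ, hκ, map_zero]
        ext l : 1
        by_cases hl : l = i
        · subst hl; simp [Pi.single_eq_of_ne hik]
        · simp [Pi.single_eq_of_ne hl]
      rw [NonUnitalStarAlgHom.comp_apply, NonUnitalStarAlgHom.comp_apply, ← map_mul, this,
        map_zero]) (fun k => hlift k P _)
  refine ⟨fun n => sumHom π (fun k => θ k n) (ho n), fun b => ?_⟩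
  have e : seqOfHoms (fun n => sumHom π (fun k => θ k n) (ho n)) b
      = ∑ k, seqOfHoms (θ k) (π k b) := by
    ext n
    rw [lp.coeFn_sum, Finset.sum_apply]
    rfl
  rw [e, map_sum]
  nth_rw 2 [← hsum b]
  rw [map_sum]
  exact Finset.sum_congr rfl fun k _ => hθ k (π k b)

/-! ### Positivity -/

theorem eq_zero_of_sum_star_mul_self_eq_zero {A ι : Type*} [CStarAlgebra A] (s : Finset ι)
    (x : ι → A) (h : ∑ i ∈ s, star (x i) * x i = 0) : ∀ i ∈ s, x i = 0 := by
  let := CStarAlgebra.spectralOrder A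
  have := CStarAlgebra.spectralOrderedRing A
  intro i hi
  exact CStarRing.star_mul_self_eq_zero_iff _ |>.1
    ((Finset.sum_eq_zero_iff_of_nonneg fun i _ => star_mul_self_nonneg (x i)).1 h i hi)

theorem norm_mul_norm_le_norm_sum {A ι : Type*} [CStarAlgebra A] (s : Finset ι)
    (x : ι → A) {i : ι} (hi : i ∈ s) : ‖x i‖ * ‖x i‖ ≤ ‖∑ k ∈ s, x k * star (x k)‖ := by
  let := CStarAlgebra.spectralOrder A
  have := CStarAlgebra.spectralOrderedRing A
  rw [← CStarRing.norm_self_mul_star]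
  exact CStarAlgebra.norm_le_norm_of_nonneg_of_le (mul_star_self_nonneg _)
    (Finset.single_le_sum (f := fun k => x k * star (x k))
      (fun k _ => mul_star_self_nonneg (x k)) hi)

theorem exists_posPart_negPart {B : Type*} [CStarAlgebra B] {M : B} (hM : IsSelfAdjoint M) :
    ∃ K S : B, M = star K * K - star S * S ∧ star S * S * (star K * K) = 0 := by
  let := CStarAlgebra.spectralOrder B
  have := CStarAlgebra.spectralOrderedRing B
  obtain ⟨K, hK⟩ := CStarAlgebra.nonneg_iff_eq_star_mul_self.1 (CFC.posPart_nonneg M)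
  obtain ⟨S, hS⟩ := CStarAlgebra.nonneg_iff_eq_star_mul_self.1 (CFC.negPart_nonneg M)
  refine ⟨K, S, ?_, ?_⟩
  · rw [← hK, ← hS, CFC.posPart_sub_negPart M hM]
  · rw [← hK, ← hS, CFC.negPart_mul_posPart]

/-- A self-adjoint matrix whose quadratic form takes positive values is positive. -/
theorem exists_eq_star_mul_self_of_form {P : Type u} [CStarAlgebra P] {n : ℕ}
    (M : CStarMatrix (Fin n) (Fin n) P) (hM : IsSelfAdjoint M)
    (h : ∀ c : Fin n → P, ∃ b : P, ∑ j, (∑ k, star (c k) * M k j) * c j = star b * b) :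
    ∃ R : CStarMatrix (Fin n) (Fin n) P, M = star R * R := by
  obtain ⟨K, S, hKS, hSK⟩ := exists_posPart_negPart hM
  set N := star S * S with hS
  have hNs : star N = N := by rw [hS, star_mul, star_star]
  -- `N` is the negative part of `M`. Testing the form on the columns of `N` shows that the diagonal
  -- of `N M N = -N³` is positive, whereas that of `N³ = (SN)*(SN)` is positive too; hence `SN = 0`
  -- and `N = 0`.
  have hNMN : N * M * N = -(N * N * N) := by
    rw [hKS, mul_sub, hSK, zero_sub, neg_mul]
  have hZ : star (S * N) * (S * N) = N * N * N := by
    rw [star_mul, hNs, mul_assoc, ← mul_assoc (star S), ← hS, ← mul_assoc]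
  have hZ0 : S * N = 0 := by
    ext l i
    obtain ⟨b, hb⟩ := h fun k => N k i
    have e1 : (N * M * N) i i = star b * b := by
      rw [← hb, CStarMatrix.mul_apply]
      refine Finset.sum_congr rfl fun j _ => ?_
      rw [CStarMatrix.mul_apply]
      congr 1
      refine Finset.sum_congr rfl fun k _ => ?_
      nth_rw 1 [← hNs]
      rw [CStarMatrix.star_apply]
    have e2 : (star (S * N) * (S * N)) i i
        = ∑ l, star ((S * N) l i) * (S * N) l i := by
      rw [CStarMatrix.mul_apply]
      rfl
    rw [hNMN, ← hZ, CStarMatrix.neg_apply, e2] at e1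
    -- The extra index `none` carries `b`, so that all squares form one vanishing sum.
    have e3 : ∑ o : Option (Fin n), star (o.elim b fun l => (S * N) l i) *
        (o.elim b fun l => (S * N) l i) = 0 := by
      rw [Fintype.sum_option]
      simp only [Option.elim]
      rw [← e1, neg_add_cancel]
    exact eq_zero_of_sum_star_mul_self_eq_zero _ _ e3 (some l) (Finset.mem_univ _)
  have hN3 : N * N * N = 0 := by rw [← hZ, hZ0, mul_zero]
  have hN2 : N * N = 0 := by
    rw [← CStarRing.star_mul_self_eq_zero_iff, star_mul, hNs, ← mul_assoc, hN3, zero_mul]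
  have hN1 : N = 0 := by
    rw [← CStarRing.star_mul_self_eq_zero_iff, hNs, hN2]
  exact ⟨K, by rw [hKS, hN1, sub_zero]⟩

/-! ### Projections whose expectation is the inverse of the index -/

/-- If the conditional expectation of a projection `e` is the inverse of the index, then
`e x = Index · e F(e x)` for every `x`. -/
theorem mul_eq_index_mul_expectation {Q : Type*} [NonUnitalRing Q] [StarRing Q] {n : ℕ}
    (one : Q) (one_mul' : ∀ x : Q, one * x = x)
    (F : Q →+ Q) (hFl : ∀ x y, F (F x * y) = F x * F y) (hFr : ∀ x y, F (x * F y) = F x * F y)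
    (hFs : ∀ x, F (star x) = star (F x))
    (u v : Fin n → Q) (hl : ∀ x, x = ∑ i, u i * F (v i * x)) (hr : ∀ x, x = ∑ i, F (x * u i) * v i)
    (e c : Q) (hes : star e = e) (hee : e * e = e) (hcuv : c = ∑ i, u i * v i)
    (hc : ∀ x, c * x = x * c) (hcs : star c = c) (hFc : F c = c) (hce : F e * c = one)
    (R : Fin n → Fin n → Q) (hR : ∀ k j, F (star (u k) * u j) = ∑ l, star (R l k) * R l j)
    (hpos : ∀ y : Fin n → Q, ∑ l, y l * star (y l) = 0 → ∀ l, y l = 0) (x : Q) :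
    e * x = c * (e * F (e * x)) := by
  have hFcl : ∀ x, F (c * x) = c * F x := fun x => by
    have := hFl c x
    rwa [hFc] at this
  -- The claim is `T = 0`. The next facts show that `T` is linear over the range of `F`, idempotent,
  -- and self-adjoint for the inner product `F(x* y)`.
  set T : Q →+ Q := AddMonoidHom.mulLeft e - (AddMonoidHom.mulLeft c).comp
    ((AddMonoidHom.mulLeft e).comp (F.comp (AddMonoidHom.mulLeft e))) with hTdef
  have hT : ∀ x, T x = e * x - c * (e * F (e * x)) := fun x => rfl
  have hTr : ∀ x y, T (x * F y) = T x * F y := by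
    intro x y
    rw [hT, hT, ← mul_assoc, hFr, sub_mul]
    simp only [mul_assoc]
  have hFeT : ∀ x, F (e * T x) = 0 := by
    intro x
    have h1 : e * (c * (e * F (e * x))) = c * (e * F (e * x)) := by
      rw [← mul_assoc, ← hc, mul_assoc, ← mul_assoc e, hee]
    rw [hT, mul_sub, ← mul_assoc, hee, h1, map_sub, hFcl, hFr, ← mul_assoc, hc, hce, one_mul',
      sub_self]
  have heT : ∀ x, e * T x = T x := by
    intro x
    rw [hT, mul_sub, ← mul_assoc, hee, ← mul_assoc, ← hc, mul_assoc, ← mul_assoc e, hee]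
  have hTT : ∀ x, T (T x) = T x := by
    intro x
    rw [hT (T x), hFeT, mul_zero, mul_zero, sub_zero, heT]
  have hsymm : ∀ x y, F (star (T x) * y) = F (star x * T y) := by
    intro x y
    have hs : star (T x) = star x * e - F (star x * e) * (e * c) := by
      rw [hT, star_sub, star_mul, star_mul, star_mul, hes, hcs, ← hFs, star_mul, hes, mul_assoc]
    have h1 : F (F (star x * e) * (e * c) * y) = c * (F (star x * e) * F (e * y)) := by
      rw [mul_assoc, hFl, ← hc, mul_assoc, hFcl, ← mul_assoc, ← hc, mul_assoc]
    have h2 : F (star x * (c * (e * F (e * y)))) = c * (F (star x * e) * F (e * y)) := by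
      rw [← mul_assoc, ← hc, mul_assoc, hFcl, ← mul_assoc, hFr]
    rw [hs, hT, sub_mul, mul_sub, map_sub, map_sub, h1, h2, mul_assoc]
  have hTexp : ∀ x, T x = ∑ j, T (u j) * F (v j * x) := by
    intro x
    conv_lhs => rw [hl x]
    rw [map_sum]
    exact Finset.sum_congr rfl fun j _ => hTr _ _
  -- The trace of `T` is `e c - c e e`, by the reconstruction formula applied to `e`.
  have hTuv : ∑ i, T (u i) * v i = 0 := by
    have h1 : ∀ i, T (u i) * v i = e * (u i * v i) - c * (e * (F (e * u i) * v i)) := by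
      intro i
      rw [hT, sub_mul]
      simp only [mul_assoc]
    simp only [h1]
    rw [Finset.sum_sub_distrib, ← Finset.mul_sum, ← Finset.mul_sum, ← Finset.mul_sum, ← hr, hee,
      ← hcuv, hc, sub_self]
  set X : Fin n → Q := fun k => T (star (v k)) with hX
  -- Write `T = T²` in the trace, expand in the quasi-basis, and move one `T` across the inner
  -- product.
  have hsum : ∑ j, T (u j) * star (X j) = 0 := by
    rw [← hTuv]
    have h1 : ∀ i, T (u i) * v i = ∑ j, T (u j) * (F (star (X j) * u i) * v i) := by
      intro i
      conv_lhs => rw [← hTT, hTexp (T (u i)), Finset.sum_mul]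
      refine Finset.sum_congr rfl fun j _ => ?_
      rw [mul_assoc, hX, hsymm, star_star]
    simp only [h1]
    rw [Finset.sum_comm]
    refine Finset.sum_congr rfl fun j _ => ?_
    rw [← Finset.mul_sum, ← hr]
  have hu : ∀ j, u j = ∑ k, star (v k) * F (star (u k) * u j) := by
    intro j
    have := congrArg star (hr (star (u j)))
    rw [star_star, star_sum] at this
    rw [this]
    refine Finset.sum_congr rfl fun k _ => ?_
    rw [star_mul, ← hFs, star_mul, star_star, ← this]
  -- By the adjoint quasi-basis formula, `T(uⱼ) = ∑ₖ Xₖ Gₖⱼ` with Gram matrix `G = R* R`. Hence the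
  -- vanishing sum is `X G X* = Y Y*` with `Y = X R*`.
  set Y : Fin n → Q := fun l => ∑ k, X k * star (R l k) with hY
  have hTu : ∀ j, T (u j) = ∑ l, Y l * R l j := by
    intro j
    conv_lhs => rw [hu j]
    simp only [map_sum, hTr]
    simp only [hR, hY, Finset.mul_sum, Finset.sum_mul, mul_assoc]
    rw [Finset.sum_comm]
  have hYY : ∑ l, Y l * star (Y l) = 0 := by
    rw [← hsum]
    simp only [hTu, Finset.sum_mul]
    rw [Finset.sum_comm]
    refine Finset.sum_congr rfl fun l _ => ?_
    conv_lhs => rw [hY]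
    simp only [star_sum, star_mul, star_star, Finset.mul_sum, ← mul_assoc]
    rfl
  have hT0 : T x = 0 := by
    rw [hTexp]
    refine Finset.sum_eq_zero fun j _ => ?_
    rw [hTu, Finset.sum_eq_zero fun l _ => by rw [hpos Y hYY l, zero_mul], zero_mul]
  rw [hT] at hT0
  exact sub_eq_zero.1 hT0

/-! ### Conditional expectations on sequence algebras -/

namespace CondExpectation

variable {A : Type u} [CStarAlgebra A] {P : StarSubalgebra ℂ A}

theorem map_mul_left (E : CondExpectation P) (x : P) (a : A) :
    E.toMap (x * a) = x * E.toMap a := by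
  simpa using E.map_mul_mul x a 1

theorem map_mul_right (E : CondExpectation P) (a : A) (x : P) :
    E.toMap (a * x) = E.toMap a * x := by
  simpa using E.map_mul_mul 1 a x

theorem map_one (E : CondExpectation P) : E.toMap 1 = 1 := E.map_coe 1

/-- Positivity makes `E(x* x)` self-adjoint, and such elements span `A` by polarization. -/
theorem map_star (E : CondExpectation P) (a : A) : E.toMap (star a) = star (E.toMap a) := by
  have hpos : ∀ x : A, E.toMap (star (star x * x)) = star (E.toMap (star x * x)) := by
    intro x
    obtain ⟨b, hb⟩ := E.map_nonneg x
    rw [star_mul, star_star, hb, star_mul, star_star]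
  have hsa : ∀ x : A, IsSelfAdjoint x → star (E.toMap x) = E.toMap x := by
    intro x hx
    have e : x = (1 / 4 : ℂ) • (star (x + 1) * (x + 1) - star (x - 1) * (x - 1)) := by
      have : star (x + 1) * (x + 1) - star (x - 1) * (x - 1) = (4 : ℂ) • x := by
        rw [star_add, star_sub, hx.star_eq, star_one, show (4 : ℂ) • x = x + x + x + x by
          rw [show (4 : ℂ) = 1 + 1 + 1 + 1 by norm_num]; simp only [add_smul, one_smul]]
        noncomm_ring
      rw [this, smul_smul]
      norm_num
    rw [e, map_smul, map_sub, star_smul, star_sub, ← hpos, ← hpos]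
    simp only [star_mul, star_star]
    norm_num
  obtain ⟨x, y, hx, hy, rfl⟩ : ∃ x y : A, IsSelfAdjoint x ∧ IsSelfAdjoint y ∧
      a = x + Complex.I • y :=
    ⟨realPart a, imaginaryPart a, (realPart a).2, (imaginaryPart a).2,
      (realPart_add_I_smul_imaginaryPart a).symm⟩
  rw [star_add, star_smul, map_add, map_smul, map_add, map_smul, star_add, star_smul,
    hsa x hx, hsa y hy, hx.star_eq, hy.star_eq]

/-- Expand `a uᵢ` by the left quasi-basis formula and resum by the right one. -/
theorem index_comm (E : CondExpectation P) (h : E.FiniteIndex) (a : A) :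
    E.index h * a = a * E.index h := by
  set q := h.some
  have hi : E.index h = ∑ i, q.u i * q.v i := rfl
  rw [hi, Finset.sum_mul, Finset.mul_sum]
  symm
  calc ∑ i, a * (q.u i * q.v i)
      = ∑ i, (∑ j, q.u j * (E.toMap (q.v j * (a * q.u i)) : A)) * q.v i :=
        Finset.sum_congr rfl fun i _ => by rw [← q.eq_left, mul_assoc]
    _ = ∑ j, q.u j * ∑ i, (E.toMap (q.v j * a * q.u i) : A) * q.v i := by
        simp only [Finset.mul_sum, Finset.sum_mul, mul_assoc]
        exact Finset.sum_comm
    _ = ∑ j, q.u j * q.v j * a :=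
        Finset.sum_congr rfl fun j _ => by rw [← q.eq_right, mul_assoc]

end CondExpectation

theorem exists_quotMk_eq {A : Type u} [CStarAlgebra A] (x : SeqAlg A) :
    ∃ f : BddSeq A, (c0Ideal A).quotMk f = x := (c0Ideal A).toQuot_surjective x

/-- The quotient is used here only as a *-algebra, so positivity is applied termwise to
representatives: each `‖f l k‖²` is at most the norm of the sum, which tends to zero. -/
theorem seqAlg_eq_zero_of_sum_mul_star {A : Type u} [CStarAlgebra A] {n : ℕ}
    (y : Fin n → SeqAlg A) (h : ∑ l, y l * star (y l) = 0) (l : Fin n) : y l = 0 := by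
  choose f hf using fun l => exists_quotMk_eq (y l)
  have h' : (c0Ideal A).quotMk (∑ l, f l * star (f l)) = (c0Ideal A).quotMk 0 := by
    rw [map_sum, map_zero, ← h]
    exact Finset.sum_congr rfl fun l _ => by rw [map_mul, map_star, hf]
  rw [quotMk_c0_eq_iff] at h'
  have h2 := tendsto_zero_iff_norm_tendsto_zero.1 h'
  rw [← hf l, ← map_zero (c0Ideal A).quotMk, quotMk_c0_eq_iff, tendsto_zero_iff_norm_tendsto_zero]
  have h3 := (Real.continuous_sqrt.tendsto 0).comp h2
  rw [Real.sqrt_zero] at h3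
  refine squeeze_zero (fun _ => norm_nonneg _) (fun k => Real.le_sqrt_of_sq_le ?_) h3
  have h4 := norm_mul_norm_le_norm_sum Finset.univ (fun l => f l k) (Finset.mem_univ l)
  have e : (∑ l, f l * star (f l) : BddSeq A) k = ∑ l, f l k * star (f l k) := by
    rw [lp.coeFn_sum, Finset.sum_apply]
    rfl
  change ‖f l k - 0‖ ^ 2 ≤ ‖(∑ l, f l * star (f l) : BddSeq A) k - 0‖
  rw [e, sub_zero, sub_zero, sq]
  exact h4

/-- `toSeqAlg` as a *-homomorphism. -/
def toSeqAlgHom (A : Type u) [CStarAlgebra A] : A →⋆ₙₐ[ℂ] SeqAlg A where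
  toFun := toSeqAlg
  map_smul' _ _ := rfl
  map_zero' := rfl
  map_add' _ _ := rfl
  map_mul' _ _ := rfl
  map_star' _ := rfl

theorem toSeqAlg_one_mul {A : Type u} [CStarAlgebra A] (x : SeqAlg A) : toSeqAlg 1 * x = x := by
  obtain ⟨f, rfl⟩ := exists_quotMk_eq x
  rw [toSeqAlg, ← map_mul]
  congr 1
  ext n
  exact one_mul (f n)

theorem mul_toSeqAlg_one {A : Type u} [CStarAlgebra A] (x : SeqAlg A) : x * toSeqAlg 1 = x := by
  obtain ⟨f, rfl⟩ := exists_quotMk_eq x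
  rw [toSeqAlg, ← map_mul]
  congr 1
  ext n
  exact mul_one (f n)

/-- The inclusion `P^∞ → A^∞`. -/
def seqIncl {A : Type u} [CStarAlgebra A] (P : StarSubalgebra ℂ A) [IsClosed (P : Set A)] :
    SeqAlg P →⋆ₙₐ[ℂ] SeqAlg A where
  toFun := seqMap (inclL P)
  map_smul' := map_smul _
  map_zero' := map_zero _
  map_add' := map_add _
  map_mul' x y := by
    obtain ⟨f, rfl⟩ := exists_quotMk_eq x
    obtain ⟨g, rfl⟩ := exists_quotMk_eq y
    rfl
  map_star' x := by
    obtain ⟨f, rfl⟩ := exists_quotMk_eq x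
    rfl

theorem seqIncl_injective {A : Type u} [CStarAlgebra A] (P : StarSubalgebra ℂ A)
    [IsClosed (P : Set A)] : Function.Injective (seqIncl P) := by
  intro x y h
  obtain ⟨f, rfl⟩ := exists_quotMk_eq x
  obtain ⟨g, rfl⟩ := exists_quotMk_eq y
  have h' := quotMk_c0_eq_iff.1
    (show (c0Ideal A).quotMk (bddSeqMap (inclL P) f) = (c0Ideal A).quotMk (bddSeqMap (inclL P) g)
      from h)
  rw [quotMk_c0_eq_iff, tendsto_zero_iff_norm_tendsto_zero]
  exact (tendsto_zero_iff_norm_tendsto_zero (f := fun n => (f n : A) - g n)).1 h'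

section

variable {A : Type u} [CStarAlgebra A] {P : StarSubalgebra ℂ A} [IsClosed (P : Set A)]

theorem CondExpectation.seqMap_mul_left (E : CondExpectation P) (y : SeqAlg P) (x : SeqAlg A) :
    seqMap E.toMap (seqIncl P y * x) = y * seqMap E.toMap x := by
  obtain ⟨f, rfl⟩ := exists_quotMk_eq x
  obtain ⟨g, rfl⟩ := exists_quotMk_eq y
  change (c0Ideal P).quotMk (bddSeqMap E.toMap (bddSeqMap (inclL P) g * f))
    = (c0Ideal P).quotMk (g * bddSeqMap E.toMap f)
  congr 1
  ext n : 2
  exact E.map_mul_left (g n) (f n)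

theorem CondExpectation.seqMap_mul_right (E : CondExpectation P) (x : SeqAlg A) (y : SeqAlg P) :
    seqMap E.toMap (x * seqIncl P y) = seqMap E.toMap x * y := by
  obtain ⟨f, rfl⟩ := exists_quotMk_eq x
  obtain ⟨g, rfl⟩ := exists_quotMk_eq y
  change (c0Ideal P).quotMk (bddSeqMap E.toMap (f * bddSeqMap (inclL P) g))
    = (c0Ideal P).quotMk (bddSeqMap E.toMap f * g)
  congr 1
  ext n : 2
  exact E.map_mul_right (f n) (g n)

theorem CondExpectation.seqMap_star (E : CondExpectation P) (x : SeqAlg A) :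
    seqMap E.toMap (star x) = star (seqMap E.toMap x) := by
  obtain ⟨f, rfl⟩ := exists_quotMk_eq x
  change (c0Ideal P).quotMk (bddSeqMap E.toMap (star f))
    = (c0Ideal P).quotMk (star (bddSeqMap E.toMap f))
  congr 1
  ext n : 2
  exact E.map_star (f n)

theorem CondExpectation.seqMap_eq_left (E : CondExpectation P) (q : E.QuasiBasis) (x : SeqAlg A) :
    x = ∑ i, toSeqAlg (q.u i) * seqIncl P (seqMap E.toMap (toSeqAlg (q.v i) * x)) := by
  obtain ⟨f, rfl⟩ := exists_quotMk_eq x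
  change _ = ∑ i, (c0Ideal A).quotMk
    (constSeq (q.u i) * bddSeqMap (inclL P) (bddSeqMap E.toMap (constSeq (q.v i) * f)))
  rw [← map_sum]
  congr 1
  ext n : 2
  rw [lp.coeFn_sum, Finset.sum_apply]
  exact q.eq_left (f n)

theorem CondExpectation.seqMap_eq_right (E : CondExpectation P) (q : E.QuasiBasis) (x : SeqAlg A) :
    x = ∑ i, seqIncl P (seqMap E.toMap (x * toSeqAlg (q.u i))) * toSeqAlg (q.v i) := by
  obtain ⟨f, rfl⟩ := exists_quotMk_eq x
  change _ = ∑ i, (c0Ideal A).quotMk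
    (bddSeqMap (inclL P) (bddSeqMap E.toMap (f * constSeq (q.u i))) * constSeq (q.v i))
  rw [← map_sum]
  congr 1
  ext n : 2
  rw [lp.coeFn_sum, Finset.sum_apply]
  exact q.eq_right (f n)

/-- The form of the Gram matrix at `c` is `E(w* w)` with `w = ∑ uⱼ cⱼ`, by the bimodule property. So
positivity of `E` alone suffices. -/
theorem CondExpectation.exists_gram_eq_star_mul_self (E : CondExpectation P) {n : ℕ}
    (u : Fin n → A) :
    ∃ R : CStarMatrix (Fin n) (Fin n) P,
      ∀ k j, E.toMap (star (u k) * u j) = ∑ l, star (R l k) * R l j := by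
  obtain ⟨R, hR⟩ := exists_eq_star_mul_self_of_form
    (CStarMatrix.ofMatrix fun k j => E.toMap (star (u k) * u j)) (by
      refine CStarMatrix.ext fun k j => ?_
      change star (E.toMap (star (u j) * u k)) = E.toMap (star (u k) * u j)
      rw [← E.map_star, star_mul, star_star]) (fun c => by
      obtain ⟨b, hb⟩ := E.map_nonneg (∑ j, u j * (c j : A))
      refine ⟨b, ?_⟩
      rw [← hb, star_sum, Finset.mul_sum, map_sum]
      refine Finset.sum_congr rfl fun j _ => ?_
      rw [Finset.sum_mul, Finset.sum_mul, map_sum]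
      refine Finset.sum_congr rfl fun k _ => ?_
      rw [star_mul, ← mul_assoc, mul_assoc (star _) (star _)]
      exact (E.map_mul_mul (star (c k)) _ (c j)).symm)
  refine ⟨R, fun k j => ?_⟩
  have := congrFun (congrFun hR k) j
  exact this

/-- A finite-index inclusion with the Rohlin property admits a unital *-homomorphism
`A → P^∞` that restricts to the canonical embedding of `P`. -/
theorem IsRohlinInclusion.exists_hom (hP : IsRohlinInclusion P) :
    ∃ β : A →⋆ₙₐ[ℂ] SeqAlg P, ∀ p : P, β (p : A) = toSeqAlg p := by
  obtain ⟨E, h, e, hcent, he, hce, hce', -⟩ := hP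
  have hcent : ∀ a, toSeqAlg a * e = e * toSeqAlg a := hcent
  set c := toSeqAlg (E.index h) with hc_def
  set F : SeqAlg A →ₗ[ℂ] SeqAlg A := (seqMap (inclL P)).comp (seqMap E.toMap) with hF_def
  have hF : ∀ x, F x = seqIncl P (seqMap E.toMap x) := fun _ => rfl
  have hFl : ∀ x y, F (F x * y) = F x * F y := fun x y => by
    rw [hF, hF x, E.seqMap_mul_left, map_mul, hF]
  have hFr : ∀ x y, F (x * F y) = F x * F y := fun x y => by
    rw [hF, hF y, E.seqMap_mul_right, map_mul, hF]
  have hFs : ∀ x, F (star x) = star (F x) := fun x => by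
    rw [hF, E.seqMap_star, map_star, hF]
  have hes : star e = e := he.isSelfAdjoint
  have hee : e * e = e := he.isIdempotentElem
  have hce : F e * c = toSeqAlg 1 := hce
  have hce' : c * F e = toSeqAlg 1 := hce'
  have hF1 : F (toSeqAlg 1) = toSeqAlg 1 := by
    change toSeqAlg ((E.toMap 1 : P) : A) = toSeqAlg 1
    rw [E.map_one]
    rfl
  -- `c` is the inverse of `F e`, which lies in the range of `F`; so `c` is fixed by `F`. Likewise
  -- `c` is self-adjoint because `F e` is.
  have hFc : F c = c := by
    calc F c = c * F e * F c := by rw [hce', toSeqAlg_one_mul]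
      _ = c := by rw [mul_assoc, ← hFl, hce, hF1, mul_toSeqAlg_one]
  have hcs : star c = c := by
    have h1 : star c * F e = toSeqAlg 1 := by
      have := congrArg star hce
      rw [star_mul, ← hFs, hes] at this
      rw [this]
      exact congrArg toSeqAlg (star_one A)
    calc star c = star c * (F e * c) := by rw [hce, mul_toSeqAlg_one]
      _ = c := by rw [← mul_assoc, h1, toSeqAlg_one_mul]
  have hc : ∀ x, c * x = x * c := by
    intro x
    obtain ⟨f, rfl⟩ := exists_quotMk_eq x
    change (c0Ideal A).quotMk (constSeq (E.index h) * f) = (c0Ideal A).quotMk (f * constSeq _)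
    congr 1
    ext n : 2
    exact E.index_comm h (f n)
  have hFcl : ∀ x, F (c * x) = c * F x := fun x => by
    have := hFl c x
    rwa [hFc] at this
  set q := h.some with hq
  obtain ⟨R, hR⟩ := E.exists_gram_eq_star_mul_self q.u
  have key : ∀ x, e * x = c * (e * F (e * x)) :=
    mul_eq_index_mul_expectation (toSeqAlg 1) toSeqAlg_one_mul F.toAddMonoidHom hFl hFr hFs
      (fun i => toSeqAlg (q.u i)) (fun i => toSeqAlg (q.v i)) (E.seqMap_eq_left q)
      (E.seqMap_eq_right q) e c hes hee
      (map_sum (toSeqAlgHom A) (fun i => q.u i * q.v i) Finset.univ)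
      hc hcs hFc hce (fun l k => toSeqAlg (R l k : A)) (fun k j => by
        change toSeqAlg ((E.toMap (star (q.u k) * q.u j) : P) : A) = _
        rw [hR]
        exact map_sum ((toSeqAlgHom A).comp
          (P.subtype : P →⋆ₙₐ[ℂ] A)) (fun l => star (R l k) * R l j) Finset.univ)
      seqAlg_eq_zero_of_sum_mul_star
  have hJ : ∀ a, seqIncl P (seqMap E.toMap (c * (e * toSeqAlg a))) = c * F (e * toSeqAlg a) :=
    fun a => by rw [← hF, hFcl]
  refine ⟨{ toFun := fun a => seqMap E.toMap (c * (e * toSeqAlg a))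
            map_smul' := fun z a => ?_
            map_zero' := ?_
            map_add' := fun a b => ?_
            map_mul' := fun a b => seqIncl_injective P ?_
            map_star' := fun a => seqIncl_injective P ?_ }, fun p => seqIncl_injective P ?_⟩
  · change seqMap E.toMap (c * (e * toSeqAlgHom A (z • a))) = _
    rw [map_smul, mul_smul_comm, mul_smul_comm, map_smul]
    rfl
  · change seqMap E.toMap (c * (e * toSeqAlgHom A 0)) = _
    rw [map_zero, mul_zero, mul_zero, map_zero]
  · change seqMap E.toMap (c * (e * toSeqAlgHom A (a + b))) = _
    rw [map_add, mul_add, mul_add, map_add]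
    rfl
  · rw [map_mul (seqIncl P), hJ, hJ, hJ]
    -- `e` commutes with `a`, and the key identity reads `e b = e F(c e b)`. The factor `F(c e b)`
    -- then leaves `F` by the module property.
    have h1 : e * toSeqAlg (a * b) = e * toSeqAlg a * F (c * (e * toSeqAlg b)) := by
      have hk : e * toSeqAlg b = e * F (c * (e * toSeqAlg b)) := by
        rw [hFcl, ← mul_assoc, ← hc, mul_assoc, ← key]
      rw [toSeqAlg_mul, ← mul_assoc, ← hcent, mul_assoc, mul_assoc]
      conv_lhs => rw [hk]
    rw [h1, hFr, hFcl, mul_assoc]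
  · rw [map_star (seqIncl P), hJ, hJ, star_mul, ← hFs, star_mul, hcs, hes, hc]
    congr 2
    exact (hcent (star a)).symm
  · change seqIncl P (seqMap E.toMap (c * (e * toSeqAlg (p : A)))) = toSeqAlg (p : A)
    rw [hJ]
    have h1 : F (e * toSeqAlg (p : A)) = F e * toSeqAlg (p : A) := by
      have h2 : toSeqAlg (p : A) = F (toSeqAlg (p : A)) := by
        change _ = toSeqAlg ((E.toMap (p : A) : P) : A)
        rw [E.map_coe]
      rw [h2, hFr]
    rw [h1, ← mul_assoc, hce', toSeqAlg_one_mul]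

end

/-! ### The main theorem -/

/-- Unital *-homomorphisms into a sequence algebra are contractive. -/
theorem eventually_norm_lt_of_hom {A P : Type u} [CStarAlgebra A] [CStarAlgebra P]
    (β : A →⋆ₙₐ[ℂ] SeqAlg P) (hβ : β 1 = toSeqAlg 1) {x : A} {f : BddSeq P}
    (hf : (c0Ideal P).quotMk f = β x) {r : ℝ} (hr : ‖x‖ < r) : ∀ᶠ n in atTop, ‖f n‖ < r := by
  -- The norm bound is encoded as the algebraic identity `‖x‖² = x* x + y* y`, which `β` carries to
  -- the quotient, where it holds asymptotically for representatives.
  obtain ⟨y, hy⟩ : ∃ y : A, algebraMap ℂ A (‖x‖ ^ 2 : ℝ) = star x * x + star y * y := by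
    let := CStarAlgebra.spectralOrder A
    have := CStarAlgebra.spectralOrderedRing A
    obtain ⟨y, hy⟩ := CStarAlgebra.nonneg_iff_eq_star_mul_self.1
      (sub_nonneg.2 (CStarAlgebra.star_mul_le_algebraMap_norm_sq (a := x)))
    refine ⟨y, ?_⟩
    rw [← hy, add_sub_cancel]
    rfl
  obtain ⟨g, hg⟩ := exists_quotMk_eq (β y)
  have h1 : (c0Ideal P).quotMk (star f * f + star g * g)
      = (c0Ideal P).quotMk (((‖x‖ ^ 2 : ℝ) : ℂ) • constSeq 1) := by
    rw [map_add, map_mul, map_mul, map_star, map_star, hf, hg, ← map_star, ← map_star, ← map_mul,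
      ← map_mul, ← map_add, ← hy, map_smul, Algebra.algebraMap_eq_smul_one, map_smul, hβ]
    rfl
  rw [quotMk_c0_eq_iff] at h1
  have h2 := tendsto_zero_iff_norm_tendsto_zero.1 h1
  have hx := norm_nonneg x
  have hlt : (0 : ℝ) < r ^ 2 - ‖x‖ ^ 2 := by nlinarith
  filter_upwards [h2.eventually (gt_mem_nhds hlt)] with n hn
  have h3 : ‖star (f n) * f n + star (g n) * g n - ((‖x‖ ^ 2 : ℝ) : ℂ) • (1 : P)‖
      < r ^ 2 - ‖x‖ ^ 2 := hn
  have h4 : ‖((‖x‖ ^ 2 : ℝ) : ℂ) • (1 : P)‖ ≤ ‖x‖ ^ 2 := by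
    rw [norm_smul, Complex.norm_real, Real.norm_of_nonneg (by positivity)]
    exact mul_le_of_le_one_right (by positivity) (IsStarProjection.norm_le 1 (.one P))
  have h5 : ‖f n‖ * ‖f n‖ ≤ ‖star (f n) * f n + star (g n) * g n‖ := by
    have := norm_mul_norm_le_norm_sum Finset.univ ![star (f n), star (g n)] (Finset.mem_univ 0)
    simpa using this
  have h6 := norm_add_le (star (f n) * f n + star (g n) * g n - ((‖x‖ ^ 2 : ℝ) : ℂ) • (1 : P))
    (((‖x‖ ^ 2 : ℝ) : ℂ) • (1 : P))
  rw [sub_add_cancel] at h6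
  exact lt_of_pow_lt_pow_left₀ 2 (by linarith) (by nlinarith)

end

theorem mainTheorem2 (𝒞 : CStarClass.{u}) (hsep : 𝒞.IsSeparable) (hflex : 𝒞.IsFlexible)
    (A : Type u) [CStarAlgebra A] (P : StarSubalgebra ℂ A) [IsClosed (P : Set A)]
    (hP : IsRohlinInclusion P) (hA : 𝒞.IsUnitalLocal A) :
    𝒞.IsUnitalLocal P := by
  classical
  refine ⟨?_, fun S ε hε => ?_⟩
  · have := hA.separable
    have := UniformSpace.secondCountable_of_separable A
    exact inferInstanceAs (TopologicalSpace.SeparableSpace {x // x ∈ P})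
  obtain ⟨β, hβ⟩ := hP.exists_hom
  have hβ1 : β 1 = toSeqAlg 1 := hβ 1
  obtain ⟨B, _, hB, φ, hφ⟩ := hA.approx (S.image fun a : P => (a : A)) ε hε
  have hb : ∀ a ∈ S, ∃ b : B, ‖φ b - a‖ < ε := by
    intro a ha
    obtain ⟨_, ⟨b, rfl⟩, hb⟩ := (Metric.infDist_lt_iff (Set.range_nonempty φ)).1
      (hφ a (Finset.mem_image_of_mem _ ha))
    exact ⟨b, by rwa [dist_comm, dist_eq_norm] at hb⟩
  choose! b hb using hb
  obtain ⟨θ, hθ⟩ := liftsSequences_of_finiteSaturation hflex hB P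
    (β.comp (φ : B →⋆ₙₐ[ℂ] A))
  have hθφ : ∀ x, (c0Ideal P).quotMk (seqOfHoms θ x) = β (φ x) := hθ
  -- `1 - θ n 1` is a projection, and a projection of norm less than `1` is zero.
  have h1 : ∀ᶠ n in atTop, θ n 1 = 1 := by
    have h := hθφ 1
    rw [map_one, hβ1] at h
    have h' := tendsto_zero_iff_norm_tendsto_zero.1 (quotMk_c0_eq_iff.1 h)
    filter_upwards [h'.eventually (gt_mem_nhds one_pos)] with n hn
    have hn : ‖θ n 1 - 1‖ < 1 := hn
    have hp := (isStarProjection_map_one (θ n)).one_sub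
    rw [← norm_neg, neg_sub] at hn
    have hpp : ‖1 - θ n 1‖ * ‖1 - θ n 1‖ = ‖1 - θ n 1‖ := by
      rw [← CStarRing.norm_star_mul_self, hp.isSelfAdjoint.star_eq, hp.isIdempotentElem.eq]
    have h0 : ‖1 - θ n 1‖ = 0 := by nlinarith [norm_nonneg (1 - θ n 1)]
    exact (sub_eq_zero.1 (norm_eq_zero.1 h0)).symm
  have h2 : ∀ᶠ n in atTop, ∀ a ∈ S, ‖θ n (b a) - a‖ < ε := by
    rw [Finset.eventually_all]
    intro a ha
    -- Since `β` fixes `P`, the sequence `θ n (b a) - a` represents `β(φ(b a) - a)`.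
    refine eventually_norm_lt_of_hom β hβ1 (x := φ (b a) - a)
      (f := seqOfHoms θ (b a) - constSeq a) ?_ (hb a ha)
    rw [map_sub, map_sub, hθφ, hβ]
    rfl
  obtain ⟨n, hn1, hn2⟩ := (h1.and h2).exists
  refine ⟨B, inferInstance, hB,
    { toFun := θ n
      map_one' := hn1
      map_mul' := map_mul (θ n)
      map_zero' := map_zero (θ n)
      map_add' := map_add (θ n)
      commutes' := fun z => by
        rw [Algebra.algebraMap_eq_smul_one, map_smul, hn1, Algebra.algebraMap_eq_smul_one]
      map_star' := map_star (θ n) }, fun a ha => ?_⟩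
  refine (Metric.infDist_le_dist_of_mem (Set.mem_range_self (b a))).trans_lt ?_
  rw [dist_comm, dist_eq_norm]
  exact hn2 a ha
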